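/- Let $(M,d_M)$ be a compact metric space of diameter $1$ and let $\Omega=M^{\mathbb N}$ carry the metric $d(x,y)=\sum_{n\ge 1}2^{-n}d_M(x_n,y_n)$ and the shift $\sigma(x_1,x_2,\dots)=(x_2,x_3,\dots)$. Let $\nu$ be a Borel probability measure on $M$ with support $M$. For a Lipschitz function $f:\Omega\to\mathbb R$ let $\mathcal L_f w(x)=\int_M e^{f(ax)}w(ax)\,d\nu(a)$, where $ax=(a,x_1,x_2,\dots)$, be the Ruelle operator, and let $\mathcal L_f^*$ be the dual of $\mathcal L_f$ acting on $C(\Omega)$. Let $(\lambda_f,w_f,\rho_f)$ be the triple given by the Ruelle–Perron–Frobenius theorem: $\lambda_f>0$, $w_f$ is a strictly positive Lipschitz function, $\rho_f$ is a Borel probability measure on $\Omega$, and $\mathcal L_f w_f=\lambda_f w_f$, $\mathcal L_f^*\rho_f=\lambda_f\rho_f$, $\int_\Omega w_f\,d\rho_f=1$. Put $P(f)=\log\lambda_f$ (the pressure) and $N(f)=f+\log w_f-\log (w_f\circ\sigma)-\log\lambda_f$, and let $\mu_f$ be the unique Borel probability measure on $\Omega$ with $\mathcal L_{N(f)}^*\mu_f=\mu_f$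 (the Lipschitz–Gibbs probability of $f$). Let $f,g:\Omega\to\mathbb R$ be Lipschitz with $\int_\Omega g\,d\mu_f=0$, and for $t\in\mathbb R$ put $p(t)=P(f+tg)$ and $\beta(t)=P(f+tg)-P(f)=p(t)-p(0)$. Then $p$ and $\beta$ are twice differentiable on $\mathbb R$ and, for every $s\in\mathbb R$, $$p''(s)=\beta''(s)=\lim_{n\to\infty}\frac1n\int_\Omega\Bigl(\sum_{j=0}^{n-1}\bigl(g\circ\sigma^j-\beta'(s)\bigr)\Bigr)^2\,d\mu_{f+sg},$$ where the limit exists. The right-hand side is called the asymptotic variance $\sigma^2_{f+sg}(g)$. -/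

import Mathlib

open MeasureTheory Filter Topology

noncomputable section

namespace XYModel

variable {M : Type*}

/-- The shift map `(x₁, x₂, x₃, …) ↦ (x₂, x₃, …)` on `Ω = M^ℕ`. Coordinates are indexed
from `0`, so `xₙ` is `x (n - 1)`. -/
def shift (x : ℕ → M) : ℕ → M := fun n => x (n + 1)

/-- The sequence `a x = (a, x₁, x₂, …)`. -/
def prepend (a : M) (x : ℕ → M) : ℕ → M
  | 0 => a
  | n + 1 => x n

/-- The metric `d(x, y) = ∑_{n ≥ 1} 2⁻ⁿ d_M(xₙ, yₙ)` on `Ω` (with coordinates indexed from `0`).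
The series converges because `M` is bounded. -/
def seqDist [MetricSpace M] (x y : ℕ → M) : ℝ :=
  ∑' n : ℕ, (1 / 2 : ℝ) ^ (n + 1) * dist (x n) (y n)

/-- Membership in `Lip(Ω)`: real functions on `Ω` that are Lipschitz for `seqDist`. -/
def IsLip [MetricSpace M] (f : (ℕ → M) → ℝ) : Prop :=
  ∃ K : ℝ, ∀ x y : ℕ → M, |f x - f y| ≤ K * seqDist x y

/-- The Ruelle operator `(L_f w)(x) = ∫_M e^{f(ax)} w(ax) dν(a)`. -/
def ruelle [MeasurableSpace M] (ν : Measure M) (f w : (ℕ → M) → ℝ) : (ℕ → M) → ℝ :=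
  fun x => ∫ a, Real.exp (f (prepend a x)) * w (prepend a x) ∂ν

/-- `L_f^* ρ = c ρ`, for the dual of the Ruelle operator acting on `C(Ω)`. -/
def IsDualEigen [MetricSpace M] [MeasurableSpace M] (ν : Measure M) (f : (ℕ → M) → ℝ)
    (c : ℝ) (ρ : Measure (ℕ → M)) : Prop :=
  ∀ φ : (ℕ → M) → ℝ, Continuous φ → ∫ x, ruelle ν f φ x ∂ρ = c * ∫ x, φ x ∂ρ

/-- The data `(λ_f, w_f, ρ_f)` of the Ruelle-Perron-Frobenius theorem: a number `λ_f > 0`, a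
strictly positive Lipschitz function `w_f` and a Borel probability `ρ_f` with `L_f w_f = λ_f w_f`,
`L_f^* ρ_f = λ_f ρ_f` and `∫ w_f dρ_f = 1`. For Lipschitz `f` exactly one such triple exists. -/
structure IsRPF [MetricSpace M] [MeasurableSpace M] (ν : Measure M) (f : (ℕ → M) → ℝ)
    (lam : ℝ) (w : (ℕ → M) → ℝ) (ρ : Measure (ℕ → M)) : Prop where
  lam_pos : 0 < lam
  lip : IsLip w
  pos : ∀ x, 0 < w x
  prob : IsProbabilityMeasure ρ
  eigenfunction : ∀ x, ruelle ν f w x = lam * w x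
  eigenmeasure : IsDualEigen ν f lam ρ
  normalized : ∫ x, w x ∂ρ = 1

/-- The triple `(λ_f, w_f, ρ_f)`. -/
def rpf [MetricSpace M] [MeasurableSpace M] (ν : Measure M) (f : (ℕ → M) → ℝ) :
    ℝ × ((ℕ → M) → ℝ) × Measure (ℕ → M) :=
  Classical.epsilon fun t => IsRPF ν f t.1 t.2.1 t.2.2

/-- The main eigenvalue `λ_f`. -/
def mainEigenvalue [MetricSpace M] [MeasurableSpace M] (ν : Measure M) (f : (ℕ → M) → ℝ) : ℝ :=
  (rpf ν f).1

/-- The main eigenfunction `w_f`. -/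
def mainEigenfunction [MetricSpace M] [MeasurableSpace M] (ν : Measure M)
    (f : (ℕ → M) → ℝ) : (ℕ → M) → ℝ :=
  (rpf ν f).2.1

/-- The pressure `P(f) = log λ_f`. -/
def pressure [MetricSpace M] [MeasurableSpace M] (ν : Measure M) (f : (ℕ → M) → ℝ) : ℝ :=
  Real.log (mainEigenvalue ν f)

/-- The normalization `N(f) = f + log w_f - log (w_f ∘ σ) - log λ_f`. -/
def normalization [MetricSpace M] [MeasurableSpace M] (ν : Measure M)
    (f : (ℕ → M) → ℝ) : (ℕ → M) → ℝ :=
  fun x => f x + Real.log (mainEigenfunction ν f x)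
    - Real.log (mainEigenfunction ν f (shift x)) - Real.log (mainEigenvalue ν f)

/-- The Lipschitz-Gibbs probability `μ_f`: the unique Borel probability on `Ω` fixed by the dual
of the Ruelle operator of `N(f)`. -/
def gibbs [MetricSpace M] [MeasurableSpace M] (ν : Measure M) (f : (ℕ → M) → ℝ) :
    Measure (ℕ → M) :=
  Classical.epsilon fun μ => IsProbabilityMeasure μ ∧ IsDualEigen ν (normalization ν f) 1 μ

end XYModel

end

set_option linter.unusedSectionVars false

/-! Everything is expanded around one parameter $s$, using normalization and a martingale–coboundary
decomposition in place of analytic perturbation theory. Let $A=N(f+sg)$, $m=\mu_{f+sg}$, $c=\int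
g\,dm$, so $L_A1=1$. Solving a Poisson equation gives $g-c=\psi-u+u\circ\sigma$ with $L_A\psi=0$
(`exists_martingale_coboundary`). Up to a coboundary and a constant, $f+(s+t)g$ is therefore
$A+t\psi$, and its eigenvalue is $\lambda_{f+sg}e^{tc}\Lambda$ with $\Lambda$ an eigenvalue of
$L_{A+t\psi}$.

Since $L_A\psi=0$, the first-order term disappears: $\Lambda$ and the normalized eigenfunction are
$1+O(t^2)$ (`exists_eigen_perturbation`). Taking logarithms gives $p'(s)=\int g\,d\mu_{f+sg}$ for
every $s$. The second derivative is obtained by differentiating this mean: invariance of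
$\mu_{f+(s+t)g}$, tested on $\psi$, gives $\int g\,d\mu_{f+(s+t)g}=c+t\int\psi^2\,dm+O(t^2)$
(`exists_linear_response`). Finally $\int\psi^2\,dm$ is the asymptotic variance, because the
$\psi\circ\sigma^j$ are orthogonal in $L^2(m)$ and the coboundary contributes a bounded term
(`tendsto_variance`).

The analytic input is a contraction of a power of $L_A$ on Lipschitz functions modulo constants
(`exists_contraction`), which yields the Poisson equation with control of the Lipschitz constant.
The triple and the Gibbs measure are `Classical.epsilon` choices, so their existence is proved too.
-/

namespace XYModel

/-! ### The metric on the sequence space and the algebra of Lipschitz functions. -/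

section Basic

variable {M : Type*}

/-- `h` is Lipschitz with constant `K` for `seqDist`. -/
def LipBound [MetricSpace M] (K : ℝ) (h : (ℕ → M) → ℝ) : Prop :=
  ∀ x y : ℕ → M, |h x - h y| ≤ K * seqDist x y

theorem shift_prepend (a : M) (x : ℕ → M) : shift (prepend a x) = x := rfl

theorem continuous_shift [TopologicalSpace M] : Continuous (shift : (ℕ → M) → ℕ → M) :=
  continuous_pi fun n => continuous_apply (n + 1)

theorem continuous_prepend [TopologicalSpace M] :
    Continuous fun q : M × (ℕ → M) => prepend q.1 q.2 := by
  refine continuous_pi fun n => ?_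
  cases n with
  | zero => exact continuous_fst
  | succ n => exact (continuous_apply n).comp continuous_snd

theorem dist_le_one [MetricSpace M] [CompactSpace M]
    (hM : Metric.diam (Set.univ : Set M) = 1) (a b : M) : dist a b ≤ 1 :=
  hM ▸ Metric.dist_le_diam_of_mem isCompact_univ.isBounded (Set.mem_univ a) (Set.mem_univ b)

section Metric

variable [MetricSpace M] (hd : ∀ a b : M, dist a b ≤ 1)

theorem hasSum_half_pow : HasSum (fun n : ℕ => (1 / 2 : ℝ) ^ (n + 1)) 1 := by
  refine (hasSum_geometric_two' (1 : ℝ)).congr_fun fun n => ?_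
  rw [pow_succ, one_div_pow]
  ring

include hd in
theorem seqDist_term_le (x y : ℕ → M) (n : ℕ) :
    (1 / 2 : ℝ) ^ (n + 1) * dist (x n) (y n) ≤ (1 / 2 : ℝ) ^ (n + 1) :=
  mul_le_of_le_one_right (by positivity) (hd _ _)

include hd in
theorem summable_seqDist (x y : ℕ → M) :
    Summable fun n : ℕ => (1 / 2 : ℝ) ^ (n + 1) * dist (x n) (y n) :=
  Summable.of_nonneg_of_le (fun _ => by positivity) (seqDist_term_le hd x y)
    hasSum_half_pow.summable

theorem seqDist_nonneg (x y : ℕ → M) : 0 ≤ seqDist x y :=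
  tsum_nonneg fun _ => by positivity

theorem seqDist_self (x : ℕ → M) : seqDist x x = 0 := by simp [seqDist]

theorem seqDist_comm (x y : ℕ → M) : seqDist x y = seqDist y x := by
  simp only [seqDist, dist_comm]

include hd in
theorem seqDist_le_one (x y : ℕ → M) : seqDist x y ≤ 1 := by
  rw [← hasSum_half_pow.tsum_eq]
  exact (summable_seqDist hd x y).tsum_le_tsum (seqDist_term_le hd x y) hasSum_half_pow.summable

include hd in
theorem seqDist_eq (x y : ℕ → M) :
    seqDist x y = 1 / 2 * dist (x 0) (y 0) + 1 / 2 * seqDist (shift x) (shift y) := by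
  rw [seqDist, (summable_seqDist hd x y).tsum_eq_zero_add, seqDist, ← tsum_mul_left]
  congr 1
  · simp
  · refine tsum_congr fun n => ?_
    rw [shift, shift]
    ring

include hd in
theorem seqDist_prepend (a : M) (x y : ℕ → M) :
    seqDist (prepend a x) (prepend a y) = seqDist x y / 2 := by
  rw [seqDist_eq hd, shift_prepend, shift_prepend]
  simp [prepend]
  ring

include hd in
theorem seqDist_shift_le (x y : ℕ → M) : seqDist (shift x) (shift y) ≤ 2 * seqDist x y := by
  rw [seqDist_eq hd x y]
  linarith [dist_nonneg (x := x 0) (y := y 0)]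

include hd in
theorem continuous_seqDist : Continuous fun q : (ℕ → M) × (ℕ → M) => seqDist q.1 q.2 := by
  refine continuous_tsum (fun n => ?_) hasSum_half_pow.summable fun n q => ?_
  · fun_prop
  · rw [Real.norm_of_nonneg (by positivity)]
    exact seqDist_term_le hd _ _ n

namespace LipBound

variable {K K' : ℝ} {h h' : (ℕ → M) → ℝ}

theorem isLip (H : LipBound K h) : IsLip h := ⟨K, H⟩

theorem mono (H : LipBound K h) (hK : K ≤ K') : LipBound K' h := fun x y =>
  (H x y).trans (mul_le_mul_of_nonneg_right hK (seqDist_nonneg x y))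

theorem const (c : ℝ) : LipBound 0 (fun _ : ℕ → M => c) := fun x y => by simp

theorem add (H : LipBound K h) (H' : LipBound K' h') : LipBound (K + K') fun x => h x + h' x := by
  intro x y
  have h1 := abs_le.1 (H x y)
  have h2 := abs_le.1 (H' x y)
  rw [abs_le]
  constructor <;> nlinarith

theorem sub (H : LipBound K h) (H' : LipBound K' h') : LipBound (K + K') fun x => h x - h' x := by
  intro x y
  have h1 := abs_le.1 (H x y)
  have h2 := abs_le.1 (H' x y)
  rw [abs_le]
  constructor <;> nlinarith

theorem const_mul (H : LipBound K h) (c : ℝ) : LipBound (|c| * K) fun x => c * h x := by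
  intro x y
  rw [← mul_sub, abs_mul, mul_assoc]
  exact mul_le_mul_of_nonneg_left (H x y) (abs_nonneg c)

theorem mul {B B' : ℝ} (H : LipBound K h) (H' : LipBound K' h') (hB : ∀ x, |h x| ≤ B)
    (hB' : ∀ x, |h' x| ≤ B') (hK : 0 ≤ K) :
    LipBound (B' * K + B * K') fun x => h x * h' x := by
  intro x y
  have e : h x * h' x - h y * h' y = (h x - h y) * h' x + h y * (h' x - h' y) := by ring
  have d0 := seqDist_nonneg x y
  calc |h x * h' x - h y * h' y| ≤ |h x - h y| * |h' x| + |h y| * |h' x - h' y| := by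
        rw [e, ← abs_mul, ← abs_mul]; exact abs_add_le _ _
    _ ≤ (K * seqDist x y) * B' + B * (K' * seqDist x y) := by
        gcongr
        · exact H x y
        · exact hB' x
        · exact (abs_nonneg _).trans (hB y)
        · exact hB y
        · exact H' x y
    _ = _ := by ring

/-- Composition with a real function that is `C`-Lipschitz on `s`. -/
theorem comp {C : ℝ} {s : Set ℝ} {F : ℝ → ℝ} (H : LipBound K h) (hs : ∀ x, h x ∈ s) (hC : 0 ≤ C)
    (hF : ∀ a ∈ s, ∀ b ∈ s, |F a - F b| ≤ C * |a - b|) : LipBound (C * K) fun x => F (h x) := by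
  intro x y
  refine (hF _ (hs x) _ (hs y)).trans ?_
  rw [mul_assoc]
  exact mul_le_mul_of_nonneg_left (H x y) hC

include hd in
theorem comp_shift (H : LipBound K h) (hK : 0 ≤ K) : LipBound (2 * K) fun x => h (shift x) := by
  intro x y
  refine (H _ _).trans ?_
  nlinarith [seqDist_shift_le hd x y]

include hd in
theorem continuous (H : LipBound K h) : Continuous h := by
  rw [continuous_iff_continuousAt]
  intro x
  rw [ContinuousAt, tendsto_iff_dist_tendsto_zero]
  have h1 : Tendsto (fun y => K * seqDist y x) (𝓝 x) (𝓝 0) := by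
    have : Continuous fun y => K * seqDist y x :=
      continuous_const.mul ((continuous_seqDist hd).comp (continuous_id.prodMk continuous_const))
    simpa [seqDist_self] using this.tendsto x
  exact squeeze_zero (fun _ => dist_nonneg) (fun y => H y x) h1

include hd in
theorem abs_sub_le (H : LipBound K h) (hK : 0 ≤ K) (x y : ℕ → M) : |h x - h y| ≤ K :=
  (H x y).trans (mul_le_of_le_one_right hK (seqDist_le_one hd x y))

end LipBound

theorem IsLip.exists_nonneg {h : (ℕ → M) → ℝ} (H : IsLip h) : ∃ K, 0 ≤ K ∧ LipBound K h := by
  obtain ⟨K, hK⟩ := H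
  exact ⟨max K 0, le_max_right _ _, LipBound.mono hK (le_max_left _ _)⟩

include hd in
theorem IsLip.continuous {h : (ℕ → M) → ℝ} (H : IsLip h) : Continuous h :=
  LipBound.continuous hd H.choose_spec

theorem IsLip.add {h h' : (ℕ → M) → ℝ} (H : IsLip h) (H' : IsLip h') :
    IsLip fun x => h x + h' x :=
  (LipBound.add H.choose_spec H'.choose_spec).isLip

theorem IsLip.sub {h h' : (ℕ → M) → ℝ} (H : IsLip h) (H' : IsLip h') :
    IsLip fun x => h x - h' x :=
  (LipBound.sub H.choose_spec H'.choose_spec).isLip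

theorem IsLip.const_mul {h : (ℕ → M) → ℝ} (H : IsLip h) (c : ℝ) : IsLip fun x => c * h x :=
  (LipBound.const_mul H.choose_spec c).isLip

theorem isLip_const (c : ℝ) : IsLip fun _ : ℕ → M => c := (LipBound.const c).isLip

include hd in
theorem IsLip.comp_shift {h : (ℕ → M) → ℝ} (H : IsLip h) : IsLip fun x => h (shift x) := by
  obtain ⟨K, hK, H⟩ := H.exists_nonneg
  exact (H.comp_shift hd hK).isLip

theorem exists_abs_le [CompactSpace M] {h : (ℕ → M) → ℝ} (H : Continuous h) :
    ∃ B, 0 ≤ B ∧ ∀ x, |h x| ≤ B := by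
  obtain ⟨B, hB⟩ := isCompact_univ.exists_bound_of_continuousOn (H.continuousOn (s := Set.univ))
  exact ⟨max B 0, le_max_right _ _, fun x => (hB x trivial).trans (le_max_left _ _)⟩

theorem exists_pos_le [CompactSpace M] [Nonempty M] {h : (ℕ → M) → ℝ} (H : Continuous h)
    (h0 : ∀ x, 0 < h x) : ∃ δ, 0 < δ ∧ ∀ x, δ ≤ h x := by
  obtain ⟨x, -, hx⟩ := isCompact_univ.exists_isMinOn Set.univ_nonempty
    (H.continuousOn (s := Set.univ))
  exact ⟨h x, h0 x, fun y => hx (Set.mem_univ y)⟩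

include hd in
theorem IsLip.mul [CompactSpace M] {h h' : (ℕ → M) → ℝ} (H : IsLip h) (H' : IsLip h') :
    IsLip fun x => h x * h' x := by
  obtain ⟨K, hK, H1⟩ := H.exists_nonneg
  obtain ⟨K', H1'⟩ := id H'
  obtain ⟨B, -, hB⟩ := exists_abs_le (H.continuous hd)
  obtain ⟨B', -, hB'⟩ := exists_abs_le (H'.continuous hd)
  exact (H1.mul H1' hB hB' hK).isLip

theorem abs_exp_sub_exp_le {B a b : ℝ} (ha : |a| ≤ B) (hb : |b| ≤ B) :
    |Real.exp a - Real.exp b| ≤ Real.exp B * |a - b| := by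
  have := (convex_Icc (-B) B).norm_image_sub_le_of_norm_deriv_le (f := Real.exp)
    (C := Real.exp B) (fun x _ => Real.differentiableAt_exp) (fun x hx => by
      rw [Real.deriv_exp, Real.norm_of_nonneg (Real.exp_pos _).le]
      exact Real.exp_le_exp.2 hx.2) (abs_le.1 hb) (abs_le.1 ha)
  simpa using this

include hd in
theorem IsLip.exp [CompactSpace M] {h : (ℕ → M) → ℝ} (H : IsLip h) :
    IsLip fun x => Real.exp (h x) := by
  obtain ⟨B, -, hB⟩ := exists_abs_le (H.continuous hd)
  exact (LipBound.comp (s := {a | |a| ≤ B}) H.choose_spec hB (Real.exp_pos B).le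
    fun a ha b hb => abs_exp_sub_exp_le ha hb).isLip

theorem abs_log_sub_log_le {δ a b : ℝ} (hδ : 0 < δ) (ha : δ ≤ a) (hb : δ ≤ b) :
    |Real.log a - Real.log b| ≤ δ⁻¹ * |a - b| := by
  have := (convex_Ici δ).norm_image_sub_le_of_norm_deriv_le (f := Real.log)
    (C := δ⁻¹) (fun x hx => Real.differentiableAt_log (hδ.trans_le hx).ne') (fun x hx => by
      rw [Real.deriv_log, Real.norm_of_nonneg (inv_nonneg.2 (hδ.trans_le hx).le)]
      exact inv_anti₀ hδ hx) (Set.mem_Ici.2 hb) (Set.mem_Ici.2 ha)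
  simpa using this

include hd in
theorem IsLip.log [CompactSpace M] [Nonempty M] {h : (ℕ → M) → ℝ} (H : IsLip h)
    (h0 : ∀ x, 0 < h x) : IsLip fun x => Real.log (h x) := by
  obtain ⟨δ, hδ, hh⟩ := exists_pos_le (H.continuous hd) h0
  exact (LipBound.comp (s := Set.Ici δ) H.choose_spec hh (inv_nonneg.2 hδ.le)
    fun a ha b hb => abs_log_sub_log_le hδ ha hb).isLip

end Metric

end Basic

/-! ### The Ruelle operator and one-step estimates for normalized potentials. -/

section Operator

variable {M : Type*} [MetricSpace M] [CompactSpace M] [MeasurableSpace M] [BorelSpace M]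
  (hd : ∀ a b : M, dist a b ≤ 1) {ν : Measure M} [IsProbabilityMeasure ν]

theorem continuous_prepend_left (x : ℕ → M) : Continuous fun a : M => prepend a x :=
  continuous_prepend.comp (continuous_id.prodMk continuous_const)

theorem continuous_prepend_right (a : M) : Continuous fun x : ℕ → M => prepend a x :=
  continuous_prepend.comp (continuous_const.prodMk continuous_id)

theorem integrable_of_continuous {X : Type*} [TopologicalSpace X] [CompactSpace X]
    [MeasurableSpace X] [OpensMeasurableSpace X] {m : Measure X} [IsFiniteMeasure m]
    {φ : X → ℝ} (h : Continuous φ) : Integrable φ m :=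
  h.integrable_of_hasCompactSupport (HasCompactSupport.of_compactSpace φ)

theorem integrable_prepend {φ : (ℕ → M) → ℝ} (h : Continuous φ) (x : ℕ → M) :
    Integrable (fun a => φ (prepend a x)) ν :=
  integrable_of_continuous (h.comp (continuous_prepend_left x))

theorem integrable_ruelle {f φ : (ℕ → M) → ℝ} (hf : Continuous f) (hφ : Continuous φ)
    (x : ℕ → M) : Integrable (fun a => Real.exp (f (prepend a x)) * φ (prepend a x)) ν :=
  integrable_prepend (φ := fun z => Real.exp (f z) * φ z) (hf.rexp.mul hφ) x

theorem continuous_integral_prepend {φ : (ℕ → M) → ℝ} (h : Continuous φ) :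
    Continuous fun x => ∫ a, φ (prepend a x) ∂ν := by
  obtain ⟨B, -, hB⟩ := exists_abs_le h
  have : SecondCountableTopology M := EMetric.secondCountable_of_sigmaCompact M
  refine continuous_of_dominated (bound := fun _ => B) (fun x => ?_) (fun x => ?_)
    (integrable_const B) ?_
  · exact (integrable_prepend h x).aestronglyMeasurable
  · exact ae_of_all _ fun a => hB _
  · exact ae_of_all _ fun a => h.comp (continuous_prepend_right a)

theorem continuous_ruelle {f φ : (ℕ → M) → ℝ} (hf : Continuous f) (hφ : Continuous φ) :
    Continuous (ruelle ν f φ) :=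
  continuous_integral_prepend (φ := fun z => Real.exp (f z) * φ z) (hf.rexp.mul hφ)

theorem continuous_iterate_ruelle {f φ : (ℕ → M) → ℝ} (hf : Continuous f) (hφ : Continuous φ)
    (n : ℕ) : Continuous ((ruelle ν f)^[n] φ) := by
  induction n with
  | zero => exact hφ
  | succ n ih => rw [Function.iterate_succ_apply']; exact continuous_ruelle hf ih

theorem ruelle_add {f φ χ : (ℕ → M) → ℝ} (hf : Continuous f) (hφ : Continuous φ)
    (hχ : Continuous χ) (x : ℕ → M) :
    ruelle ν f (fun z => φ z + χ z) x = ruelle ν f φ x + ruelle ν f χ x := by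
  simp only [ruelle, mul_add]
  exact integral_add (integrable_ruelle hf hφ x) (integrable_ruelle hf hχ x)

theorem ruelle_sub {f φ χ : (ℕ → M) → ℝ} (hf : Continuous f) (hφ : Continuous φ)
    (hχ : Continuous χ) (x : ℕ → M) :
    ruelle ν f (fun z => φ z - χ z) x = ruelle ν f φ x - ruelle ν f χ x := by
  simp only [ruelle, mul_sub]
  exact integral_sub (integrable_ruelle hf hφ x) (integrable_ruelle hf hχ x)

theorem ruelle_const_mul (f φ : (ℕ → M) → ℝ) (c : ℝ) (x : ℕ → M) :
    ruelle ν f (fun z => c * φ z) x = c * ruelle ν f φ x := by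
  simp only [ruelle, mul_left_comm _ c]
  exact integral_const_mul _ _

/-- Since $\sigma(ax)=x$, functions of the shift pull out as from a conditional expectation. This is
what later kills the cross terms in the variance. -/
theorem ruelle_mul_comp_shift (f φ k : (ℕ → M) → ℝ) (x : ℕ → M) :
    ruelle ν f (fun z => φ z * k (shift z)) x = ruelle ν f φ x * k x := by
  simp only [ruelle, shift_prepend, ← mul_assoc]
  exact integral_mul_const _ _

theorem ruelle_mono {f φ χ : (ℕ → M) → ℝ} (hf : Continuous f) (hφ : Continuous φ)
    (hχ : Continuous χ) (h : ∀ x, φ x ≤ χ x) (x : ℕ → M) :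
    ruelle ν f φ x ≤ ruelle ν f χ x :=
  integral_mono (integrable_ruelle hf hφ x) (integrable_ruelle hf hχ x) fun _ =>
    mul_le_mul_of_nonneg_left (h _) (Real.exp_pos _).le

/-- A Lipschitz potential `A` with `L_A 1 = 1`. -/
structure IsNormalized (ν : Measure M) (A : (ℕ → M) → ℝ) : Prop where
  lip : IsLip A
  one : ∀ x, ∫ a, Real.exp (A (prepend a x)) ∂ν = 1

namespace IsNormalized

variable {A : (ℕ → M) → ℝ} (hA : IsNormalized ν A)

include hA

theorem ruelle_const (c : ℝ) (x : ℕ → M) : ruelle ν A (fun _ => c) x = c := by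
  simp only [ruelle]
  rw [integral_mul_const, hA.one, one_mul]

theorem ruelle_comp_shift (k : (ℕ → M) → ℝ) (x : ℕ → M) :
    ruelle ν A (fun z => k (shift z)) x = k x := by
  have := ruelle_mul_comp_shift (ν := ν) A (fun _ => 1) k x
  rw [hA.ruelle_const, one_mul] at this
  rw [← this]
  simp only [one_mul]

include hd

theorem abs_ruelle_le {φ : (ℕ → M) → ℝ} (hφ : Continuous φ) {B : ℝ} (hB : ∀ x, |φ x| ≤ B)
    (x : ℕ → M) : |ruelle ν A φ x| ≤ B := by
  have hc := hA.lip.continuous hd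
  rw [abs_le]
  constructor
  · rw [← hA.ruelle_const (-B) x]
    exact ruelle_mono hc continuous_const hφ (fun z => (abs_le.1 (hB z)).1) x
  · rw [← hA.ruelle_const B x]
    exact ruelle_mono hc hφ continuous_const (fun z => (abs_le.1 (hB z)).2) x

/-- One step of the Doeblin argument: `L_A` mixes values at distance at most `r` with the
oscillation of `h` at scale `r / 2`. -/
theorem osc_ruelle_le {δ : ℝ} (hδA : ∀ x, δ ≤ Real.exp (A x))
    (hδ : 0 ≤ δ) {h : (ℕ → M) → ℝ} (hh : Continuous h) {o b r : ℝ}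
    (ho : ∀ x y, |h x - h y| ≤ o) (hb : ∀ x y, seqDist x y ≤ r / 2 → |h x - h y| ≤ b)
    (x y : ℕ → M) (hxy : seqDist x y ≤ r) :
    |ruelle ν A h x - ruelle ν A h y| ≤ (1 - δ) * o + δ * b := by
  have hc := hA.lip.continuous hd
  suffices H : ∀ x y, seqDist x y ≤ r →
      ruelle ν A h x - ruelle ν A h y ≤ (1 - δ) * o + δ * b by
    rw [abs_sub_le_iff]
    exact ⟨H x y hxy, H y x (seqDist_comm x y ▸ hxy)⟩
  clear hxy x y
  intro x y hxy
  obtain ⟨p, -, hp⟩ := isCompact_univ.exists_isMaxOn ⟨x, trivial⟩ (hh.continuousOn (s := Set.univ))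
  obtain ⟨q, -, hq⟩ := isCompact_univ.exists_isMinOn ⟨x, trivial⟩ (hh.continuousOn (s := Set.univ))
  have hp : ∀ z, h z ≤ h p := fun z => hp (Set.mem_univ z)
  have hq : ∀ z, h q ≤ h z := fun z => hq (Set.mem_univ z)
  have hI : ∀ z, Integrable (fun a => Real.exp (A (prepend a z))) ν := fun z =>
    integrable_prepend hc.rexp z
  have hδ1 : δ ≤ 1 := by
    rw [← hA.one x]
    have := integral_mono (integrable_const δ) (hI x) fun a => hδA (prepend a x)
    simpa using this
  have hH : ∀ z, Integrable (fun a => h (prepend a z)) ν := integrable_prepend hh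
  -- Doeblin splitting: a share $\delta$ of the weight is the same measure $\nu$ at every base
  -- point, so there $x$ and $y$ are compared along a common first letter, at half the distance.
  -- Only the remaining mass $1-\delta$ pays the full oscillation.
  have split : ∀ z, ruelle ν A h z = (∫ a, (Real.exp (A (prepend a z)) - δ) * h (prepend a z) ∂ν)
      + δ * ∫ a, h (prepend a z) ∂ν := by
    intro z
    simp only [sub_mul]
    rw [integral_sub (integrable_ruelle hc hh z) ((hH z).const_mul δ), integral_const_mul, ruelle]
    ring
  have mass : ∀ z c, ∫ a, (Real.exp (A (prepend a z)) - δ) * c ∂ν = (1 - δ) * c := by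
    intro z c
    rw [integral_mul_const, integral_sub (hI z) (integrable_const δ), hA.one]
    simp
  have hJ : ∀ z, Integrable (fun a => (Real.exp (A (prepend a z)) - δ) * h (prepend a z)) ν :=
    fun z => integrable_prepend (φ := fun z => (Real.exp (A z) - δ) * h z)
      ((hc.rexp.sub continuous_const).mul hh) z
  have hJc : ∀ z c, Integrable (fun a => (Real.exp (A (prepend a z)) - δ) * c) ν :=
    fun z c => ((hI z).sub (integrable_const δ)).mul_const c
  have h1 : ∫ a, (Real.exp (A (prepend a x)) - δ) * h (prepend a x) ∂ν ≤ (1 - δ) * h p := by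
    rw [← mass x]
    exact integral_mono (hJ x) (hJc x _) fun a =>
      mul_le_mul_of_nonneg_left (hp _) (sub_nonneg.2 (hδA _))
  have h2 : (1 - δ) * h q ≤ ∫ a, (Real.exp (A (prepend a y)) - δ) * h (prepend a y) ∂ν := by
    rw [← mass y]
    exact integral_mono (hJc y _) (hJ y) fun a =>
      mul_le_mul_of_nonneg_left (hq _) (sub_nonneg.2 (hδA _))
  have h3 : (∫ a, h (prepend a x) ∂ν) - ∫ a, h (prepend a y) ∂ν ≤ b := by
    rw [← integral_sub (hH x) (hH y)]
    have := integral_mono ((hH x).sub (hH y)) (integrable_const b) fun a =>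
      (abs_le.1 (hb (prepend a x) (prepend a y) (by
        rw [seqDist_prepend hd]; linarith))).2
    simpa using this
  have h4 := (abs_le.1 (ho p q)).2
  rw [split x, split y]
  nlinarith [mul_le_mul_of_nonneg_left h4 (sub_nonneg.2 hδ1), mul_le_mul_of_nonneg_left h3 hδ]

/-- A Lasota–Yorke inequality; the factor $1/2$ comes from prepending a common letter. -/
theorem lipBound_ruelle {C : ℝ} (hC : LipBound C fun x => Real.exp (A x))
    {h : (ℕ → M) → ℝ} {o l : ℝ} (ho : ∀ x y, |h x - h y| ≤ o)
    (hl : LipBound l h) : LipBound ((l + C * o) / 2) (ruelle ν A h) := by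
  intro x y
  have hc := hA.lip.continuous hd
  have hh := hl.continuous hd
  have hI : ∀ z, Integrable (fun a => Real.exp (A (prepend a z))) ν := fun z =>
    integrable_prepend hc.rexp z
  -- Subtracting `h x` is free because both weights have total mass one. The variation of $e^A$ then
  -- multiplies the oscillation of $h$, not its size.
  have e : ruelle ν A h x - ruelle ν A h y =
      ∫ a, (Real.exp (A (prepend a x)) * (h (prepend a x) - h (prepend a y)) +
        (Real.exp (A (prepend a x)) - Real.exp (A (prepend a y))) * (h (prepend a y) - h x)) ∂ν := by
    have e1 : ∀ a, Real.exp (A (prepend a x)) * (h (prepend a x) - h (prepend a y)) +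
        (Real.exp (A (prepend a x)) - Real.exp (A (prepend a y))) * (h (prepend a y) - h x) =
        (Real.exp (A (prepend a x)) * h (prepend a x) -
          Real.exp (A (prepend a y)) * h (prepend a y)) -
        (Real.exp (A (prepend a x)) - Real.exp (A (prepend a y))) * h x := fun a => by ring
    simp only [e1]
    have i1 : Integrable (fun a => Real.exp (A (prepend a x)) * h (prepend a x) -
        Real.exp (A (prepend a y)) * h (prepend a y)) ν :=
      (integrable_ruelle hc hh x).sub (integrable_ruelle hc hh y)
    have i2 : Integrable (fun a => (Real.exp (A (prepend a x)) - Real.exp (A (prepend a y))) * h x)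
        ν := ((hI x).sub (hI y)).mul_const _
    rw [integral_sub i1 i2, integral_mul_const, integral_sub (hI x) (hI y),
      integral_sub (integrable_ruelle hc hh x) (integrable_ruelle hc hh y), hA.one, hA.one]
    simp [ruelle]
  rw [e]
  have hb : ∀ a, ‖Real.exp (A (prepend a x)) * (h (prepend a x) - h (prepend a y)) +
        (Real.exp (A (prepend a x)) - Real.exp (A (prepend a y))) * (h (prepend a y) - h x)‖ ≤
      Real.exp (A (prepend a x)) * (l * (seqDist x y / 2)) + C * (seqDist x y / 2) * o := by
    intro a
    rw [← seqDist_prepend hd a]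
    refine (norm_add_le _ _).trans (add_le_add ?_ ?_)
    · rw [norm_mul, Real.norm_of_nonneg (Real.exp_pos _).le]
      exact mul_le_mul_of_nonneg_left (hl _ _) (Real.exp_pos _).le
    · rw [norm_mul]
      exact mul_le_mul (hC _ _) (ho _ _) (norm_nonneg _) ((abs_nonneg _).trans (hC _ _))
  refine (norm_integral_le_of_norm_le
    (((hI x).mul_const _).add (integrable_const _)) (ae_of_all _ hb)).trans ?_
  rw [integral_add' ((hI x).mul_const _) (integrable_const _), integral_mul_const, hA.one]
  simp
  apply le_of_eq
  ring

theorem isLip_ruelle {h : (ℕ → M) → ℝ} (hl : IsLip h) : IsLip (ruelle ν A h) := by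
  obtain ⟨C, hC⟩ := hA.lip.exp hd
  obtain ⟨l, hl0, hl⟩ := hl.exists_nonneg
  exact (hA.lipBound_ruelle hd hC (hl.abs_sub_le hd hl0) hl).isLip

end IsNormalized

end Operator

/-! ### Contraction of a power of the operator, and the Poisson equation. -/

section Poisson

variable {M : Type*} [MetricSpace M] [CompactSpace M] [MeasurableSpace M] [BorelSpace M]
  (hd : ∀ a b : M, dist a b ≤ 1) {ν : Measure M} [IsProbabilityMeasure ν]

theorem borelSpace_seq : BorelSpace (ℕ → M) :=
  have : SecondCountableTopology M := EMetric.secondCountable_of_sigmaCompact M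
  inferInstance

theorem integrable_seq {m : Measure (ℕ → M)} [IsFiniteMeasure m] {φ : (ℕ → M) → ℝ}
    (h : Continuous φ) : Integrable φ m :=
  have : BorelSpace (ℕ → M) := borelSpace_seq
  integrable_of_continuous h

/-- The oscillation of `h` is at most `R` and its Lipschitz constant at most `K * R`. -/
def OscLip (K R : ℝ) (h : (ℕ → M) → ℝ) : Prop :=
  (∀ x y, |h x - h y| ≤ R) ∧ LipBound (K * R) h

theorem LipBound.sum {ι : Type*} (s : Finset ι) {l : ι → ℝ} {h : ι → (ℕ → M) → ℝ}
    (H : ∀ i ∈ s, LipBound (l i) (h i)) : LipBound (∑ i ∈ s, l i) fun x => ∑ i ∈ s, h i x := by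
  intro x y
  rw [← Finset.sum_sub_distrib, Finset.sum_mul]
  exact (Finset.abs_sum_le_sum_abs _ _).trans (Finset.sum_le_sum fun i hi => H i hi x y)

theorem abs_le_of_integral_eq_zero {m : Measure (ℕ → M)} [IsProbabilityMeasure m]
    {h : (ℕ → M) → ℝ} (hh : Continuous h) {R : ℝ} (hR : ∀ x y, |h x - h y| ≤ R)
    (h0 : ∫ x, h x ∂m = 0) (x : ℕ → M) : |h x| ≤ R := by
  have e : h x = ∫ y, (h x - h y) ∂m := by
    rw [integral_sub (integrable_const _) (integrable_seq hh), h0]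
    simp
  rw [e]
  have := norm_integral_le_of_norm_le_const (μ := m) (f := fun y => h x - h y)
    (ae_of_all _ fun y => hR x y)
  simpa using this

namespace IsNormalized

variable {A : (ℕ → M) → ℝ} (hA : IsNormalized ν A)

include hA hd

/-- After $k$ Doeblin steps a share $\delta^k$ of the mass compares only points at distance at most
$2^{-k}$, since the whole space has diameter at most $1$. -/
theorem osc_iterate_le {δ : ℝ} (hδA : ∀ x, δ ≤ Real.exp (A x)) (hδ : 0 ≤ δ) (k : ℕ) :
    ∀ {h : (ℕ → M) → ℝ} {o b : ℝ}, Continuous h → (∀ x y, |h x - h y| ≤ o) →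
      (∀ x y, seqDist x y ≤ (1 / 2) ^ k → |h x - h y| ≤ b) →
      ∀ x y, |(ruelle ν A)^[k] h x - (ruelle ν A)^[k] h y| ≤ (1 - δ ^ k) * o + δ ^ k * b := by
  induction k with
  | zero =>
    intro h o b _ _ hb x y
    simpa using hb x y (by simpa using seqDist_le_one hd x y)
  | succ k ih =>
    intro h o b hh ho hb x y
    rw [Function.iterate_succ_apply]
    have h1 : ∀ x y, |ruelle ν A h x - ruelle ν A h y| ≤ o := fun x y =>
      (hA.osc_ruelle_le hd hδA hδ hh ho (r := 1) (fun x y _ => ho x y) x y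
        (seqDist_le_one hd x y)).trans (by linarith)
    refine (ih (continuous_ruelle (hA.lip.continuous hd) hh) h1
      (fun x y hxy => hA.osc_ruelle_le hd hδA hδ hh ho (r := (1 / 2) ^ k) (b := b) (fun x y h => ?_)
        x y hxy) x y).trans ?_
    · exact hb x y (by rw [pow_succ]; linarith)
    · apply le_of_eq
      ring

theorem osc_ruelle_le_osc {h : (ℕ → M) → ℝ} {o : ℝ} (hh : Continuous h)
    (ho : ∀ x y, |h x - h y| ≤ o) (x y : ℕ → M) : |ruelle ν A h x - ruelle ν A h y| ≤ o :=
  (hA.osc_ruelle_le hd (δ := 0) (fun _ => (Real.exp_pos _).le) le_rfl hh ho (r := 1) (b := o)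
    (fun x y _ => ho x y) x y (seqDist_le_one hd x y)).trans (by linarith)

/-- The initial constant $l$ is halved at each step, while $Co$ reproduces itself: $(Co+Co)/2=Co$.
-/
theorem lipBound_iterate {C : ℝ} (hC : LipBound C fun x => Real.exp (A x))
    {h : (ℕ → M) → ℝ} {o l : ℝ} (ho : ∀ x y, |h x - h y| ≤ o) (ho0 : 0 ≤ C * o)
    (hl : LipBound l h) (k : ℕ) :
    (∀ x y, |(ruelle ν A)^[k] h x - (ruelle ν A)^[k] h y| ≤ o) ∧
      LipBound (l * (1 / 2) ^ k + C * o) ((ruelle ν A)^[k] h) := by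
  induction k with
  | zero => exact ⟨ho, hl.mono (by simpa using ho0)⟩
  | succ k ih =>
    rw [Function.iterate_succ_apply']
    refine ⟨hA.osc_ruelle_le_osc hd (ih.2.continuous hd) ih.1, ?_⟩
    refine (hA.lipBound_ruelle hd hC ih.1 ih.2).mono (le_of_eq ?_)
    rw [pow_succ]
    ring

/-- Some power of a normalized Ruelle operator contracts a combination of the oscillation and
the Lipschitz constant. -/
theorem exists_contraction [Nonempty M] : ∃ (k : ℕ) (θ K : ℝ), 0 ≤ θ ∧ θ < 1 ∧ 1 ≤ K ∧
    (∀ R h, 0 ≤ R → OscLip K R h → OscLip K R (ruelle ν A h)) ∧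
    ∀ R h, 0 ≤ R → OscLip K R h → OscLip K (θ * R) ((ruelle ν A)^[k] h) := by
  obtain ⟨δ, hδ, hδA⟩ := exists_pos_le (hA.lip.continuous hd).rexp fun x => Real.exp_pos (A x)
  obtain ⟨C, hC0, hC⟩ := (hA.lip.exp hd).exists_nonneg
  have hδ1 : δ ≤ 1 := by
    obtain ⟨x⟩ : Nonempty (ℕ → M) := inferInstance
    rw [← hA.one x]
    have := integral_mono (integrable_const δ)
      (integrable_prepend (ν := ν) (hA.lip.continuous hd).rexp x) fun a => hδA (prepend a x)
    simpa using this
  obtain ⟨k, hk⟩ := exists_pow_lt_of_lt_one (show 0 < 1 / (2 * (2 * C + 1)) by positivity)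
    (show (1 / 2 : ℝ) < 1 by norm_num)
  rw [lt_div_iff₀ (by positivity)] at hk
  have hδk : 0 < δ ^ k := by positivity
  have hδk1 : δ ^ k ≤ 1 := pow_le_one₀ hδ.le hδ1
  have hk0 : (0 : ℝ) < (1 / 2) ^ k := by positivity
  -- With $K=2C+1$ and $K2^{-k}\le 1/2$, the oscillation becomes at most $(1-\delta^k/2)R$ and the
  -- Lipschitz constant at most $(C+1/2)R=KR/2$. Both are within the factor $1-\delta^k/4\ge 3/4$.
  refine ⟨k, 1 - δ ^ k / 4, 2 * C + 1, by linarith, by linarith, by linarith, ?_, ?_⟩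
  · rintro R h hR ⟨h1, h2⟩
    refine ⟨hA.osc_ruelle_le_osc hd (h2.continuous hd) h1, ?_⟩
    refine (hA.lipBound_ruelle hd hC h1 h2).mono ?_
    nlinarith [mul_nonneg hC0 hR]
  · rintro R h hR ⟨h1, h2⟩
    constructor
    · intro x y
      refine (hA.osc_iterate_le hd hδA hδ.le k (h2.continuous hd) h1
        (b := R / 2) (fun x y hxy => (h2 x y).trans ?_) x y).trans ?_
      · have : (2 * C + 1) * R * seqDist x y ≤ (2 * C + 1) * R * (1 / 2) ^ k := by gcongr
        nlinarith
      · nlinarith [mul_nonneg hδk.le hR]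
    · refine (hA.lipBound_iterate hd hC h1 (mul_nonneg hC0 hR) h2 k).2.mono ?_
      have h3 : (2 * C + 1) * (1 / 2) ^ k ≤ 1 / 2 := by nlinarith
      have h4 : (2 * C + 1) * R * (1 / 2) ^ k ≤ 1 / 2 * R := by nlinarith
      nlinarith [mul_nonneg hC0 hR, mul_le_mul_of_nonneg_right hδk1 (mul_nonneg hC0 hR),
        mul_le_mul_of_nonneg_right hδk1 hR]

theorem abs_iterate_le {φ : (ℕ → M) → ℝ} (hφ : Continuous φ) {B : ℝ} (hB : ∀ x, |φ x| ≤ B)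
    (n : ℕ) (x : ℕ → M) : |(ruelle ν A)^[n] φ x| ≤ B := by
  induction n generalizing x with
  | zero => exact hB x
  | succ n ih =>
    rw [Function.iterate_succ_apply']
    exact hA.abs_ruelle_le hd (continuous_iterate_ruelle (hA.lip.continuous hd) hφ n) ih x

theorem ruelle_tsum {h : ℕ → (ℕ → M) → ℝ} (hh : ∀ j, Continuous (h j)) {b : ℕ → ℝ}
    (hb : Summable b) (hhb : ∀ j x, |h j x| ≤ b j) (x : ℕ → M) :
    ruelle ν A (fun z => ∑' j, h j z) x = ∑' j, ruelle ν A (h j) x := by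
  have hc := hA.lip.continuous hd
  simp only [ruelle, ← tsum_mul_left]
  refine (integral_tsum_of_summable_integral_norm (fun j => integrable_ruelle hc (hh j) x)
    (hb.of_nonneg_of_le (fun j => integral_nonneg fun a => norm_nonneg _) fun j => ?_)).symm
  rw [← one_mul (b j), ← hA.one x, ← integral_mul_const]
  refine integral_mono (integrable_ruelle hc (hh j) x).norm
    ((integrable_prepend hc.rexp x).mul_const _) fun a => ?_
  simp only [norm_mul, Real.norm_of_nonneg (Real.exp_pos _).le]
  exact mul_le_mul_of_nonneg_left (hhb j _) (Real.exp_pos _).le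

theorem iterate_tsum {h : ℕ → (ℕ → M) → ℝ} (hh : ∀ j, Continuous (h j)) {b : ℕ → ℝ}
    (hb : Summable b) (hhb : ∀ j x, |h j x| ≤ b j) (n : ℕ) (x : ℕ → M) :
    (ruelle ν A)^[n] (fun z => ∑' j, h j z) x = ∑' j, (ruelle ν A)^[n] (h j) x := by
  induction n generalizing x with
  | zero => rfl
  | succ n ih =>
    simp only [Function.iterate_succ_apply']
    rw [funext ih]
    exact hA.ruelle_tsum hd (fun j => continuous_iterate_ruelle (hA.lip.continuous hd) (hh j) n)
      hb (fun j x => hA.abs_iterate_le hd (hh j) (hhb j) n x) x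

theorem integral_iterate {m : Measure (ℕ → M)} (hm : IsDualEigen ν A 1 m)
    {h : (ℕ → M) → ℝ} (hh : Continuous h) (n : ℕ) :
    ∫ x, (ruelle ν A)^[n] h x ∂m = ∫ x, h x ∂m := by
  induction n with
  | zero => rfl
  | succ n ih =>
    rw [← ih, Function.iterate_succ_apply']
    simpa using hm _ (continuous_iterate_ruelle (hA.lip.continuous hd) hh n)

theorem ruelle_sum {ι : Type*} (s : Finset ι) {h : ι → (ℕ → M) → ℝ}
    (hh : ∀ i ∈ s, Continuous (h i)) (x : ℕ → M) :
    ruelle ν A (fun z => ∑ i ∈ s, h i z) x = ∑ i ∈ s, ruelle ν A (h i) x := by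
  simp only [ruelle, Finset.mul_sum]
  exact integral_finsetSum _ fun i hi => integrable_ruelle (hA.lip.continuous hd) (hh i hi) x

/-- Solution of the Poisson equation `H - L_A H = h` for Lipschitz `h` of mean zero. -/
theorem exists_poisson [Nonempty M] {m : Measure (ℕ → M)} [IsProbabilityMeasure m]
    (hm : IsDualEigen ν A 1 m) : ∃ D, 0 ≤ D ∧ ∀ l h, 0 ≤ l → LipBound l h → ∫ x, h x ∂m = 0 →
      ∃ H, LipBound (D * l) H ∧ ∀ x, H x - ruelle ν A H x = h x := by
  have hc := hA.lip.continuous hd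
  obtain ⟨k, θ, K, hθ0, hθ1, hK, hstep, hcontr⟩ := hA.exists_contraction hd
  have hθ : 0 < 1 - θ := by linarith
  refine ⟨k * (K * (1 - θ)⁻¹), by positivity, fun l h hl hh h0 => ?_⟩
  have hOL : ∀ j : ℕ, OscLip K (θ ^ j * l) ((ruelle ν A)^[k * j] h) := by
    intro j
    induction j with
    | zero =>
      rw [pow_zero, one_mul]
      exact ⟨hh.abs_sub_le hd hl, hh.mono (le_mul_of_one_le_left hl hK)⟩
    | succ j ih =>
      rw [Nat.mul_succ, add_comm (k * j), Function.iterate_add_apply, pow_succ', mul_assoc]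
      exact hcontr _ _ (by positivity) ih
  have hcont : ∀ j, Continuous ((ruelle ν A)^[k * j] h) := fun j => (hOL j).2.continuous hd
  have hbd : ∀ j x, |(ruelle ν A)^[k * j] h x| ≤ θ ^ j * l := fun j x =>
    abs_le_of_integral_eq_zero (m := m) (hcont j) (hOL j).1
      (by rw [hA.integral_iterate hd hm (hh.continuous hd), h0]) x
  have hgeo : HasSum (fun j => θ ^ j * l) ((1 - θ)⁻¹ * l) :=
    (hasSum_geometric_of_lt_one hθ0 hθ1).mul_right l
  -- Only the $k$-th power contracts, so the Neumann series runs in steps of $k$ and $E-L_A^kE=h$.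
  -- Summing $L_A^iE$ over $i<k$ then telescopes to a solution for $L_A$ itself.
  set E : (ℕ → M) → ℝ := fun x => ∑' j, (ruelle ν A)^[k * j] h x with hE
  have hs : ∀ x, Summable fun j => (ruelle ν A)^[k * j] h x := fun x =>
    Summable.of_norm_bounded hgeo.summable fun j => hbd j x
  have hsub : ∀ x y, ∀ {b : ℕ → ℝ} {B : ℝ}, HasSum b B →
      (∀ j, |(ruelle ν A)^[k * j] h x - (ruelle ν A)^[k * j] h y| ≤ b j) → |E x - E y| ≤ B := by
    intro x y b B hB hb
    rw [hE, ← (hs x).tsum_sub (hs y)]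
    exact tsum_of_norm_bounded (f := fun j => (ruelle ν A)^[k * j] h x - (ruelle ν A)^[k * j] h y)
      hB hb
  have hEOL : OscLip K ((1 - θ)⁻¹ * l) E := by
    refine ⟨fun x y => hsub x y hgeo fun j => (hOL j).1 x y, fun x y => ?_⟩
    exact hsub x y ((hgeo.mul_left K).mul_right (seqDist x y)) fun j => (hOL j).2 x y
  have hEi : ∀ i, OscLip K ((1 - θ)⁻¹ * l) ((ruelle ν A)^[i] E) := by
    intro i
    induction i with
    | zero => exact hEOL
    | succ i ih =>
      rw [Function.iterate_succ_apply']
      exact hstep _ _ (by positivity) ih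
  refine ⟨fun x => ∑ i ∈ Finset.range k, (ruelle ν A)^[i] E x, ?_, fun x => ?_⟩
  · have := LipBound.sum (Finset.range k) fun i _ => (hEi i).2
    refine this.mono (le_of_eq ?_)
    rw [Finset.sum_const, Finset.card_range, nsmul_eq_mul]
    ring
  · rw [hA.ruelle_sum hd _ fun i _ => (hEi i).2.continuous hd, ← Finset.sum_sub_distrib]
    simp only [← Function.iterate_succ_apply' (ruelle ν A)]
    have hk : (ruelle ν A)^[k] E x = ∑' j, (ruelle ν A)^[k * (j + 1)] h x := by
      rw [hE, hA.iterate_tsum hd hcont hgeo.summable hbd]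
      simp only [← Function.iterate_add_apply, Nat.mul_succ, add_comm]
    rw [Finset.sum_range_sub' (fun i => (ruelle ν A)^[i] E x), hk]
    change E x - _ = _
    rw [hE]
    simp only
    rw [(hs x).tsum_eq_zero_add, add_sub_cancel_right]
    rfl

/-- Lipschitz fixed functions of a normalized Ruelle operator are constant. -/
theorem eq_of_ruelle_eq [Nonempty M] {z : (ℕ → M) → ℝ} (hz : IsLip z)
    (hLz : ∀ x, ruelle ν A z x = z x) (x y : ℕ → M) : z x = z y := by
  obtain ⟨k, θ, K, hθ0, hθ1, hK, -, hcontr⟩ := hA.exists_contraction hd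
  obtain ⟨l, hl, hz⟩ := hz.exists_nonneg
  have hfix : ∀ n, (ruelle ν A)^[n] z = z := fun n => Function.iterate_fixed (funext hLz) n
  have hOL : ∀ j : ℕ, OscLip K (θ ^ j * l) z := by
    intro j
    induction j with
    | zero =>
      rw [pow_zero, one_mul]
      exact ⟨hz.abs_sub_le hd hl, hz.mono (le_mul_of_one_le_left hl hK)⟩
    | succ j ih =>
      rw [← hfix k, pow_succ', mul_assoc]
      exact hcontr _ _ (by positivity) ih
  have ht : Tendsto (fun j : ℕ => θ ^ j * l) atTop (𝓝 0) := by
    simpa using (tendsto_pow_atTop_nhds_zero_of_lt_one hθ0 hθ1).mul_const l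
  have := ge_of_tendsto' ht fun j => (hOL j).1 x y
  exact sub_eq_zero.1 (abs_nonpos_iff.1 this)

/-- The Lipschitz constant of `r` is controlled by that of `r - L_A r`. -/
theorem exists_lipBound_of_sub [Nonempty M] {m : Measure (ℕ → M)} [IsProbabilityMeasure m]
    (hm : IsDualEigen ν A 1 m) : ∃ D, 0 ≤ D ∧ ∀ l r, 0 ≤ l → IsLip r →
      LipBound l (fun x => r x - ruelle ν A r x) → LipBound (D * l) r := by
  have hc := hA.lip.continuous hd
  obtain ⟨D, hD, hP⟩ := hA.exists_poisson hd hm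
  refine ⟨D, hD, fun l r hl hr h => ?_⟩
  have hrc := hr.continuous hd
  obtain ⟨H, hH, hHe⟩ := hP l _ hl h (by
    rw [integral_sub (integrable_seq hrc) (integrable_seq (continuous_ruelle hc hrc)), hm r hrc]
    simp)
  -- $r-H$ is a Lipschitz fixed function of $L_A$, hence constant, so $r$ inherits the Lipschitz
  -- bound of $H$.
  have hz := hA.eq_of_ruelle_eq hd (hr.sub hH.isLip) fun x => by
    rw [ruelle_sub hc hrc (hH.continuous hd)]
    linarith [hHe x]
  intro x y
  rw [show r x - r y = H x - H y by linarith [hz x y]]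
  exact hH x y

end IsNormalized

end Poisson

/-! ### Existence of the eigenfunction and of an invariant probability. -/

section Existence

variable {M : Type*} [MetricSpace M] [CompactSpace M] [MeasurableSpace M] [BorelSpace M]
  (hd : ∀ a b : M, dist a b ≤ 1) {ν : Measure M} [IsProbabilityMeasure ν]

open scoped BoundedContinuousFunction CompactlySupported

theorem ruelle_pos [Nonempty M] {f φ : (ℕ → M) → ℝ} (hf : Continuous f) (hφ : Continuous φ)
    (h : ∀ x, 0 < φ x) (x : ℕ → M) : 0 < ruelle ν f φ x := by
  obtain ⟨δ, hδ, hδφ⟩ := exists_pos_le (hf.rexp.mul hφ) fun x => mul_pos (Real.exp_pos (f x)) (h x)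
  refine hδ.trans_le ?_
  have := integral_mono (integrable_const δ) (integrable_ruelle (ν := ν) hf hφ x)
    fun a => hδφ (prepend a x)
  simpa [ruelle] using this

/-- The operator `u ↦ log L_f(e^u)`. -/
noncomputable def logRuelle (ν : Measure M) (f u : (ℕ → M) → ℝ) (x : ℕ → M) : ℝ :=
  Real.log (ruelle ν f (fun z => Real.exp (u z)) x)

theorem exp_logRuelle [Nonempty M] {f u : (ℕ → M) → ℝ} (hf : Continuous f) (hu : Continuous u)
    (x : ℕ → M) : Real.exp (logRuelle ν f u x) = ruelle ν f (fun z => Real.exp (u z)) x :=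
  Real.exp_log (ruelle_pos hf hu.rexp (fun _ => Real.exp_pos _) x)

theorem continuous_logRuelle [Nonempty M] {f u : (ℕ → M) → ℝ} (hf : Continuous f)
    (hu : Continuous u) : Continuous (logRuelle ν f u) :=
  (continuous_ruelle hf hu.rexp).log fun x => (ruelle_pos hf hu.rexp (fun _ => Real.exp_pos _) x).ne'

/-- A comparison principle with two base points: $x=y$ gives nonexpansiveness in the sup norm, $u=v$
gives Lipschitz bounds. -/
theorem logRuelle_le [Nonempty M] {f u v : (ℕ → M) → ℝ} (hf : Continuous f) (hu : Continuous u)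
    (hv : Continuous v) {B : ℝ} {x y : ℕ → M}
    (h : ∀ a, f (prepend a x) + u (prepend a x) ≤ f (prepend a y) + v (prepend a y) + B) :
    logRuelle ν f u x ≤ logRuelle ν f v y + B := by
  rw [← Real.exp_le_exp, Real.exp_add, exp_logRuelle hf hu, exp_logRuelle hf hv, ruelle, ruelle,
    ← integral_mul_const]
  refine integral_mono (integrable_ruelle hf hu.rexp x)
    ((integrable_ruelle hf hv.rexp y).mul_const _) fun a => ?_
  simp only [← Real.exp_add]
  exact Real.exp_le_exp.2 (h a)

theorem abs_logRuelle_sub_le [Nonempty M] {f u v : (ℕ → M) → ℝ} (hf : Continuous f)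
    (hu : Continuous u) (hv : Continuous v) {B : ℝ} (h : ∀ x, |u x - v x| ≤ B) (x : ℕ → M) :
    |logRuelle ν f u x - logRuelle ν f v x| ≤ B := by
  rw [abs_sub_le_iff, sub_le_iff_le_add', sub_le_iff_le_add']
  exact ⟨logRuelle_le hf hu hv fun a => by linarith [(abs_le.1 (h (prepend a x))).2],
    logRuelle_le hf hv hu fun a => by linarith [(abs_le.1 (h (prepend a x))).1]⟩

theorem logRuelle_add_const [Nonempty M] {f u : (ℕ → M) → ℝ} (hf : Continuous f)
    (hu : Continuous u) (c : ℝ) (x : ℕ → M) :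
    logRuelle ν f (fun z => u z + c) x = logRuelle ν f u x + c := by
  have hu' : Continuous fun z => u z + c := hu.add continuous_const
  refine le_antisymm (logRuelle_le hf hu' hu fun a => by linarith) ?_
  linarith [logRuelle_le (ν := ν) (B := -c) (x := x) (y := x) hf hu hu' fun a => by linarith]

include hd in
theorem lipBound_logRuelle [Nonempty M] {f u : (ℕ → M) → ℝ} {C l : ℝ} (hf : LipBound C f)
    (hu : LipBound l u) : LipBound ((C + l) / 2) (logRuelle ν f u) := by
  have hfc := hf.continuous hd
  have huc := hu.continuous hd
  suffices H : ∀ x y, logRuelle ν f u x ≤ logRuelle ν f u y + (C + l) / 2 * seqDist x y by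
    intro x y
    rw [abs_sub_le_iff, sub_le_iff_le_add', sub_le_iff_le_add']
    exact ⟨H x y, seqDist_comm x y ▸ H y x⟩
  intro x y
  refine logRuelle_le hfc huc huc fun a => ?_
  have h1 := (abs_le.1 (hf (prepend a x) (prepend a y))).2
  have h2 := (abs_le.1 (hu (prepend a x) (prepend a y))).2
  rw [seqDist_prepend hd] at h1 h2
  linarith

/-- The potential can be moved into the argument, $L_fe^u=L_0e^{f+u}$, and $L_01=1$;
nonexpansiveness does the rest. -/
theorem abs_logRuelle_zero_le [Nonempty M] {f : (ℕ → M) → ℝ} (hf : Continuous f) {B : ℝ}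
    (hB : ∀ x, |f x| ≤ B) (x : ℕ → M) : |logRuelle ν f (fun _ => 0) x| ≤ B := by
  have h0 : logRuelle ν (fun _ => (0 : ℝ)) (fun _ : ℕ → M => (0 : ℝ)) x = 0 := by
    simp [logRuelle, ruelle]
  have key : ∀ u, logRuelle ν f u x = logRuelle ν (fun _ => (0 : ℝ)) (fun z => f z + u z) x := by
    intro u
    simp only [logRuelle, ruelle, ← Real.exp_add, zero_add]
  have := abs_logRuelle_sub_le (ν := ν) (f := fun _ : ℕ → M => (0 : ℝ)) (u := fun z => f z + 0)
    (v := fun _ => 0) continuous_const (hf.add continuous_const) continuous_const (B := B)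
    (fun z => by simpa using hB z) x
  rwa [h0, sub_zero, ← key fun _ => 0] at this

include hd in
theorem isClosed_lipBound (C : ℝ) : IsClosed {u : (ℕ → M) →ᵇ ℝ | LipBound C u} := by
  simp only [LipBound, Set.ofPred_forall]
  refine isClosed_iInter fun x => isClosed_iInter fun y => isClosed_le ?_ continuous_const
  exact ((continuous_eval_const x).sub (continuous_eval_const y)).abs

include hd in
/-- The discounted equation `u = log L_f(e^{s u})`, for `s < 1`. -/
theorem exists_discounted [Nonempty M] {f : (ℕ → M) → ℝ} {C : ℝ} (hC : 0 ≤ C)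
    (hf : LipBound C f) {s : ℝ} (hs0 : 0 ≤ s) (hs1 : s < 1) :
    ∃ u : (ℕ → M) →ᵇ ℝ, LipBound C u ∧ ∀ x, logRuelle ν f (fun z => s * u z) x = u x := by
  have hfc := hf.continuous hd
  have hcont : ∀ u : (ℕ → M) →ᵇ ℝ, Continuous fun z => s * u z := fun u =>
    continuous_const.mul u.continuous
  let T : ((ℕ → M) →ᵇ ℝ) → (ℕ → M) →ᵇ ℝ := fun u =>
    BoundedContinuousFunction.mkOfCompact ⟨_, continuous_logRuelle (ν := ν) hfc (hcont u)⟩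
  have hT : ∀ u x, T u x = logRuelle ν f (fun z => s * u z) x := fun u x => rfl
  -- The class is preserved because $(C+sC)/2\le C$, so the Lipschitz bound is uniform as $s\to1$.
  have hmaps : Set.MapsTo T {u | LipBound C u} {u | LipBound C u} := by
    intro u hu
    have h1 := hu.const_mul s
    refine (lipBound_logRuelle (ν := ν) hd hf h1).mono ?_
    rw [abs_of_nonneg hs0]
    nlinarith
  have hctr : ContractingWith ⟨s, hs0⟩ (hmaps.restrict T _ _) := by
    refine ⟨hs1, LipschitzWith.of_dist_le_mul fun u v => ?_⟩
    rw [Subtype.dist_eq, Subtype.dist_eq]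
    refine (BoundedContinuousFunction.dist_le (by positivity)).2 fun x => ?_
    refine abs_logRuelle_sub_le hfc (hcont _) (hcont _) (fun z => ?_) x
    rw [← mul_sub, abs_mul, abs_of_nonneg hs0]
    exact mul_le_mul_of_nonneg_left
      (BoundedContinuousFunction.dist_coe_le_dist (f := u.1) (g := v.1) z) hs0
  obtain ⟨u, hu, hfix, -⟩ := hctr.exists_fixedPoint' (isClosed_lipBound hd C).isComplete hmaps
    (x := 0) (fun x y => by simpa using mul_nonneg hC (seqDist_nonneg x y)) (edist_ne_top _ _)
  exact ⟨u, hu, fun x => (hT u x).symm.trans (DFunLike.congr_fun hfix x)⟩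

include hd in
/-- The eigenfunction part of the Ruelle-Perron-Frobenius theorem. -/
theorem exists_eigenfunction [Nonempty M] {f : (ℕ → M) → ℝ} (hf : IsLip f) :
    ∃ (lam : ℝ) (w : (ℕ → M) → ℝ), 0 < lam ∧ IsLip w ∧ (∀ x, 0 < w x) ∧
      ∀ x, ruelle ν f w x = lam * w x := by
  obtain ⟨C, hC, hf⟩ := hf.exists_nonneg
  have hfc := hf.continuous hd
  obtain ⟨B, hB0, hB⟩ := exists_abs_le hfc
  obtain ⟨x₀⟩ : Nonempty (ℕ → M) := inferInstance
  have hs0 : ∀ n : ℕ, (0 : ℝ) ≤ 1 - 1 / (n + 1) := fun n =>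
    sub_nonneg.2 ((div_le_one (by positivity)).2 (by linarith [n.cast_nonneg (α := ℝ)]))
  have hs1 : ∀ n : ℕ, 1 - 1 / (n + 1) < (1 : ℝ) := fun n => sub_lt_self _ (by positivity)
  choose u hu hfix using fun n : ℕ => exists_discounted (ν := ν) hd hC hf (hs0 n) (hs1 n)
  set s : ℕ → ℝ := fun n => 1 - 1 / (n + 1) with hs
  have hst : Tendsto s atTop (𝓝 1) := by
    simpa [hs] using (tendsto_one_div_add_atTop_nhds_zero_nat (𝕜 := ℝ)).const_sub 1
  have hsu : ∀ n, Continuous fun z => s n * u n z := fun n =>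
    continuous_const.mul (u n).continuous
  -- The solutions themselves need not stay bounded as $s_n\to1$, but $\|u_n\|\le B+s_n\|u_n\|$
  -- bounds $(1-s_n)u_n(x_0)$. Its limit $\kappa$ will be the logarithm of the eigenvalue, and
  -- $u_n-u_n(x_0)$ stays in a compact set by Arzelà–Ascoli.
  have hκ : ∀ n, |(1 - s n) * u n x₀| ≤ B := by
    have hb : ∀ n x, |u n x| ≤ B + s n * ‖u n‖ := by
      intro n x
      have h1 := abs_logRuelle_zero_le (ν := ν) hfc hB x
      have h2 := abs_logRuelle_sub_le (ν := ν) hfc (hsu n) continuous_const (v := fun _ => 0)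
        (B := s n * ‖u n‖) (fun z => by
          rw [sub_zero, abs_mul, abs_of_nonneg (hs0 n)]
          exact mul_le_mul_of_nonneg_left ((u n).norm_coe_le_norm z) (hs0 n)) x
      rw [hfix] at h2
      have := abs_add_le (u n x - logRuelle ν f (fun _ => 0) x) (logRuelle ν f (fun _ => 0) x)
      rw [sub_add_cancel] at this
      linarith
    intro n
    have h1 : ‖u n‖ ≤ B + s n * ‖u n‖ :=
      (BoundedContinuousFunction.norm_le (add_nonneg hB0 (mul_nonneg (hs0 n) (norm_nonneg _)))).2
        (hb n)
    have h2 := (u n).norm_coe_le_norm x₀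
    rw [Real.norm_eq_abs] at h2
    rw [abs_mul, abs_of_pos (sub_pos.2 (hs1 n))]
    nlinarith [hs1 n]
  let v : ℕ → (ℕ → M) →ᵇ ℝ := fun n => u n - BoundedContinuousFunction.const _ (u n x₀)
  have hv : ∀ n x, v n x = u n x - u n x₀ := fun n x => rfl
  have hvfix : ∀ n x, v n x + (1 - s n) * u n x₀ = logRuelle ν f (fun z => s n * v n z) x := by
    intro n x
    have := logRuelle_add_const (ν := ν) hfc (hsu n) (-(s n * u n x₀)) x
    rw [hfix] at this
    simp only [hv]
    rw [show (fun z => s n * (u n z - u n x₀)) = fun z => s n * u n z + -(s n * u n x₀) from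
      funext fun z => by ring, this]
    ring
  have hcomp : IsCompact {u : (ℕ → M) →ᵇ ℝ | LipBound C u ∧ ∀ x, u x ∈ Set.Icc (-C) C} := by
    refine BoundedContinuousFunction.arzela_ascoli₂ (Set.Icc (-C) C) isCompact_Icc _ ?_
      (fun f x hf => hf.2 x) ?_
    · have h2 : IsClosed {u : (ℕ → M) →ᵇ ℝ | ∀ x, u x ∈ Set.Icc (-C) C} := by
        rw [Set.ofPred_forall]
        exact isClosed_iInter fun x => isClosed_Icc.preimage (continuous_eval_const x)
      exact (isClosed_lipBound hd C).inter h2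
    · intro x
      rw [Metric.equicontinuousAt_iff_right]
      intro ε hε
      have h1 : Tendsto (fun y => C * seqDist x y) (𝓝 x) (𝓝 0) := by
        have : Continuous fun y => C * seqDist x y :=
          continuous_const.mul ((continuous_seqDist hd).comp (continuous_const.prodMk continuous_id))
        simpa [seqDist_self] using this.tendsto x
      filter_upwards [h1.eventually_lt_const hε] with y hy i
      exact (i.2.1 x y).trans_lt hy
  obtain ⟨⟨w, κ⟩, ⟨⟨hw, -⟩, -⟩, φ, hφ, hlim⟩ :=
    (hcomp.prod (isCompact_Icc (a := -B) (b := B))).tendsto_subseq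
      (x := fun n => (v n, (1 - s n) * u n x₀)) fun n =>
        ⟨⟨fun x y => by rw [hv, hv, sub_sub_sub_cancel_right]; exact hu n x y,
          fun x => abs_le.1 ((hu n).abs_sub_le hd hC x x₀)⟩, abs_le.1 (hκ n)⟩
  have hlimv : Tendsto (fun n => v (φ n)) atTop (𝓝 w) := (continuous_fst.tendsto _).comp hlim
  have hlimκ : Tendsto (fun n => (1 - s (φ n)) * u (φ n) x₀) atTop (𝓝 κ) :=
    (continuous_snd.tendsto _).comp hlim
  have hsv : Tendsto (fun n => s (φ n) • v (φ n)) atTop (𝓝 w) := by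
    simpa using (hst.comp hφ.tendsto_atTop).smul hlimv
  have heq : ∀ x, w x + κ = logRuelle ν f w x := by
    intro x
    have h1 : Tendsto (fun n => v (φ n) x + (1 - s (φ n)) * u (φ n) x₀) atTop (𝓝 (w x + κ)) :=
      ((continuous_eval_const x).tendsto w |>.comp hlimv).add hlimκ
    refine tendsto_nhds_unique h1 ?_
    simp only [hvfix]
    rw [tendsto_iff_dist_tendsto_zero]
    refine squeeze_zero (fun _ => dist_nonneg) (fun n => ?_) (tendsto_iff_dist_tendsto_zero.1 hsv)
    exact abs_logRuelle_sub_le hfc (continuous_const.mul (v (φ n)).continuous) w.continuous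
      (fun z => BoundedContinuousFunction.dist_coe_le_dist (f := s (φ n) • v (φ n)) (g := w) z) x
  refine ⟨Real.exp κ, fun x => Real.exp (w x), Real.exp_pos _, IsLip.exp hd hw.isLip,
    fun x => Real.exp_pos _, fun x => ?_⟩
  rw [← exp_logRuelle hfc w.continuous, ← heq, Real.exp_add, mul_comm]

include hd in
/-- A normalized Ruelle operator has an invariant probability. -/
theorem IsNormalized.exists_invariant [Nonempty M] {A : (ℕ → M) → ℝ} (hA : IsNormalized ν A) :
    ∃ m : Measure (ℕ → M), IsProbabilityMeasure m ∧ IsDualEigen ν A 1 m := by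
  have hc := hA.lip.continuous hd
  have : BorelSpace (ℕ → M) := borelSpace_seq
  obtain ⟨x₀⟩ : Nonempty (ℕ → M) := inferInstance
  let avg : ((ℕ → M) → ℝ) → ℕ → ℝ := fun φ n =>
    (n : ℝ)⁻¹ * ∑ j ∈ Finset.range n, (ruelle ν A)^[j] φ x₀
  let U : Filter ℕ := hyperfilter ℕ
  have havg : ∀ {φ : (ℕ → M) → ℝ} {B : ℝ}, Continuous φ → (∀ x, |φ x| ≤ B) →
      ∀ n, |∑ j ∈ Finset.range n, (ruelle ν A)^[j] φ x₀| ≤ n * B := by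
    intro φ B hφ hB n
    refine (Finset.abs_sum_le_sum_abs _ _).trans
      ((Finset.sum_le_sum fun j _ => hA.abs_iterate_le hd hφ hB j x₀).trans ?_)
    simp
  -- Limits of Cesàro averages along one fixed ultrafilter exist for all continuous functions at
  -- once, so they are linear in `φ` and the Riesz theorem applies. The value at discontinuous
  -- functions is a dummy.
  have hlim : ∀ φ : (ℕ → M) → ℝ, ∃ l, Continuous φ → Tendsto (avg φ) U (𝓝 l) := by
    intro φ
    by_cases hφ : Continuous φ
    · obtain ⟨B, hB0, hB⟩ := exists_abs_le hφ
      obtain ⟨l, -, hl⟩ := (isCompact_Icc (a := -B) (b := B)).ultrafilter_le_nhds'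
        ((hyperfilter ℕ).map (avg φ)) (Filter.Eventually.of_forall (f := U) fun n => by
          refine abs_le.1 ?_
          rw [abs_mul, abs_of_nonneg (by positivity)]
          refine (mul_le_mul_of_nonneg_left (havg hφ hB n) (by positivity)).trans ?_
          rw [← mul_assoc]
          exact mul_le_of_le_one_left hB0 (inv_mul_le_one))
      exact ⟨l, fun _ => hl⟩
    · exact ⟨0, fun h => absurd h hφ⟩
  choose Λ hΛ using hlim
  have hiadd : ∀ {φ χ : (ℕ → M) → ℝ}, Continuous φ → Continuous χ → ∀ (j : ℕ) x,
      (ruelle ν A)^[j] (fun z => φ z + χ z) x = (ruelle ν A)^[j] φ x + (ruelle ν A)^[j] χ x := by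
    intro φ χ hφ hχ j
    induction j with
    | zero => exact fun x => rfl
    | succ j ih =>
      intro x
      simp only [Function.iterate_succ_apply']
      rw [funext ih, ruelle_add hc (continuous_iterate_ruelle hc hφ j)
        (continuous_iterate_ruelle hc hχ j)]
  have hismul : ∀ (c : ℝ) (φ : (ℕ → M) → ℝ) (j : ℕ) x,
      (ruelle ν A)^[j] (fun z => c * φ z) x = c * (ruelle ν A)^[j] φ x := by
    intro c φ j
    induction j with
    | zero => exact fun x => rfl
    | succ j ih =>
      intro x
      simp only [Function.iterate_succ_apply']
      rw [funext ih, ruelle_const_mul]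
  have hipos : ∀ {φ : (ℕ → M) → ℝ}, (∀ x, 0 ≤ φ x) → ∀ (j : ℕ) x,
      0 ≤ (ruelle ν A)^[j] φ x := by
    intro φ hφ j
    induction j with
    | zero => exact hφ
    | succ j ih =>
      intro x
      rw [Function.iterate_succ_apply']
      exact integral_nonneg fun a => mul_nonneg (Real.exp_pos _).le (ih _)
  let Λ₀ : C_c(ℕ → M, ℝ) →ₗ[ℝ] ℝ :=
    { toFun := fun φ => Λ φ
      map_add' := fun φ χ => by
        refine tendsto_nhds_unique (hΛ _ (φ + χ).continuous) ?_
        refine ((hΛ _ φ.continuous).add (hΛ _ χ.continuous)).congr fun n => ?_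
        simp only [avg]
        rw [← mul_add, ← Finset.sum_add_distrib]
        simp only [← hiadd φ.continuous χ.continuous]
        rfl
      map_smul' := fun c φ => by
        refine tendsto_nhds_unique (hΛ _ (c • φ).continuous) ?_
        refine ((hΛ _ φ.continuous).const_mul c).congr fun n => ?_
        simp only [avg]
        rw [mul_left_comm, Finset.mul_sum]
        simp only [← hismul]
        rfl }
  let Λ₁ : C_c(ℕ → M, ℝ) →ₚ[ℝ] ℝ := PositiveLinearMap.mk₀ Λ₀ fun φ hφ =>
    ge_of_tendsto' (hΛ _ φ.continuous) fun n =>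
      mul_nonneg (by positivity) (Finset.sum_nonneg fun j _ => hipos (fun x => hφ x) j x₀)
  have hint : ∀ φ : (ℕ → M) → ℝ, Continuous φ → ∫ x, φ x ∂(RealRMK.rieszMeasure Λ₁) = Λ φ :=
    fun φ hφ => RealRMK.integral_rieszMeasure Λ₁
      ⟨⟨φ, hφ⟩, HasCompactSupport.of_compactSpace _⟩
  refine ⟨RealRMK.rieszMeasure Λ₁, ⟨?_⟩, fun φ hφ => ?_⟩
  · have h1 : Λ (fun _ => 1) = 1 := by
      refine tendsto_nhds_unique (hΛ _ continuous_const) (tendsto_const_nhds.congr' ?_)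
      -- The average for $n=0$ is $0$, not $1$, and has to be discarded.
      have hU : ∀ᶠ n in U, n ≠ 0 :=
        Nat.hyperfilter_le_atTop (eventually_ne_atTop 0)
      filter_upwards [hU] with n hn
      have : ∀ j, (ruelle ν A)^[j] (fun _ => (1 : ℝ)) = fun _ => 1 := fun j =>
        Function.iterate_fixed (funext fun x => hA.ruelle_const 1 x) j
      simp [avg, this, hn]
    rw [← hint _ continuous_const, integral_const, smul_eq_mul, mul_one, Measure.real] at h1
    exact (ENNReal.toReal_eq_one_iff _).1 h1
  · rw [one_mul, hint φ hφ]
    have hLc := continuous_ruelle (ν := ν) hc hφ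
    refine (hint _ hLc).trans (sub_eq_zero.1 ?_)
    refine tendsto_nhds_unique ((hΛ _ hLc).sub (hΛ _ hφ)) ?_
    obtain ⟨B, hB0, hB⟩ := exists_abs_le hφ
    have ht : Tendsto (fun n : ℕ => (n : ℝ)⁻¹ * (2 * B)) U (𝓝 0) := by
      have := (tendsto_inv_atTop_nhds_zero_nat (𝕜 := ℝ)).mul_const (2 * B)
      rw [zero_mul] at this
      exact this.mono_left Nat.hyperfilter_le_atTop
    refine squeeze_zero_norm (fun n => ?_) ht
    simp only [avg, ← mul_sub, ← Finset.sum_sub_distrib, ← Function.iterate_succ_apply]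
    rw [Finset.sum_range_sub (fun j => (ruelle ν A)^[j] φ x₀), norm_mul,
      Real.norm_of_nonneg (by positivity)]
    refine mul_le_mul_of_nonneg_left ?_ (by positivity)
    refine (norm_sub_le _ _).trans ?_
    have h1 := hA.abs_iterate_le hd hφ hB n x₀
    have h2 := hB x₀
    rw [Real.norm_eq_abs, Real.norm_eq_abs, Function.iterate_zero, id]
    linarith

end Existence

/-! ### The Ruelle–Perron–Frobenius triple and the Gibbs probability. -/

section Spec

variable {M : Type*} [MetricSpace M] [CompactSpace M] [MeasurableSpace M] [BorelSpace M]
  (hd : ∀ a b : M, dist a b ≤ 1) {ν : Measure M} [IsProbabilityMeasure ν] [Nonempty M]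

theorem exp_normalize {f w : (ℕ → M) → ℝ} {lam : ℝ} (hlam : 0 < lam) (hw : ∀ x, 0 < w x)
    (a : M) (x : ℕ → M) :
    Real.exp (f (prepend a x) + Real.log (w (prepend a x)) - Real.log (w (shift (prepend a x)))
      - Real.log lam) = Real.exp (f (prepend a x)) * w (prepend a x) * (lam * w x)⁻¹ := by
  rw [Real.exp_sub, Real.exp_sub, Real.exp_add, Real.exp_log (hw _), Real.exp_log (hw _),
    Real.exp_log hlam, shift_prepend]
  field_simp

theorem ruelle_normalize {f w : (ℕ → M) → ℝ} {lam : ℝ} (hlam : 0 < lam) (hw : ∀ x, 0 < w x)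
    (φ : (ℕ → M) → ℝ) (x : ℕ → M) :
    ruelle ν (fun x => f x + Real.log (w x) - Real.log (w (shift x)) - Real.log lam) φ x =
      ruelle ν f (fun z => w z * φ z) x / (lam * w x) := by
  simp only [ruelle, exp_normalize hlam hw]
  rw [div_eq_mul_inv, ← integral_mul_const]
  congr 1
  ext a
  ring

include hd

theorem isNormalized_normalize {f w : (ℕ → M) → ℝ} {lam : ℝ} (hf : IsLip f) (hlam : 0 < lam)
    (hw : ∀ x, 0 < w x) (hwl : IsLip w) (heig : ∀ x, ruelle ν f w x = lam * w x) :
    IsNormalized ν fun x => f x + Real.log (w x) - Real.log (w (shift x)) - Real.log lam := by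
  have hlog := hwl.log hd hw
  refine ⟨((hf.add hlog).sub (hlog.comp_shift hd)).sub (isLip_const _), fun x => ?_⟩
  have := ruelle_normalize (ν := ν) (f := f) hlam hw (fun _ => 1) x
  simp only [mul_one] at this
  rw [heig, div_self (mul_pos hlam (hw x)).ne'] at this
  simpa [ruelle] using this

/-- The Ruelle-Perron-Frobenius theorem: existence of the triple. -/
theorem exists_isRPF {f : (ℕ → M) → ℝ} (hf : IsLip f) : ∃ lam w ρ, IsRPF ν f lam w ρ := by
  obtain ⟨lam, w, hlam, hwl, hw, heig⟩ := exists_eigenfunction (ν := ν) hd hf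
  have hfc := hf.continuous hd
  have hwc := hwl.continuous hd
  have hA := isNormalized_normalize hd hf hlam hw hwl heig
  obtain ⟨m, hm, hinv⟩ := hA.exists_invariant hd
  have : BorelSpace (ℕ → M) := borelSpace_seq
  have hwi : Continuous fun x => (w x)⁻¹ := hwc.inv₀ fun x => (hw x).ne'
  obtain ⟨δ, hδ, hδw⟩ := exists_pos_le hwi fun x => inv_pos.2 (hw x)
  set c : ℝ := (∫ x, (w x)⁻¹ ∂m)⁻¹ with hc
  have hI : 0 < ∫ x, (w x)⁻¹ ∂m := by
    refine hδ.trans_le ?_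
    simpa using integral_mono (integrable_const δ) (integrable_seq (m := m) hwi) hδw
  have hcpos : 0 < c := inv_pos.2 hI
  -- $L_{N(f)}$ is $L_f$ conjugated by $w$ and divided by $\lambda$, so an eigenmeasure of $L_f$ is
  -- $w^{-1}m$. The constant $c$ makes it a probability, and $c^{-1}w$ is then the normalized
  -- eigenfunction.
  let ρ : Measure (ℕ → M) := m.withDensity fun x => ENNReal.ofReal (c * (w x)⁻¹)
  have hρ : ∀ φ : (ℕ → M) → ℝ, ∫ x, φ x ∂ρ = c * ∫ x, (w x)⁻¹ * φ x ∂m := by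
    intro φ
    have hmeas : Measurable fun x => c * (w x)⁻¹ := (continuous_const.mul hwi).measurable
    rw [integral_withDensity_eq_integral_toReal_smul hmeas.ennreal_ofReal
      (ae_of_all _ fun _ => ENNReal.ofReal_lt_top), ← integral_const_mul]
    congr 1
    ext x
    rw [ENNReal.toReal_ofReal (mul_pos hcpos (inv_pos.2 (hw x))).le, smul_eq_mul, mul_assoc]
  refine ⟨lam, fun x => c⁻¹ * w x, ρ, hlam, hwl.const_mul _,
    fun x => mul_pos (inv_pos.2 hcpos) (hw x), ⟨?_⟩, fun x => ?_, fun φ hφ => ?_, ?_⟩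
  · have h1 := hρ fun _ => 1
    simp only [mul_one] at h1
    rw [integral_const, smul_eq_mul, mul_one, Measure.real, hc, inv_mul_cancel₀ hI.ne'] at h1
    exact (ENNReal.toReal_eq_one_iff _).1 h1
  · rw [ruelle_const_mul, heig]
    ring
  · have h1 := hinv (fun x => (w x)⁻¹ * φ x) (hwi.mul hφ)
    simp only [ruelle_normalize hlam hw] at h1
    rw [one_mul] at h1
    rw [hρ, hρ, ← h1, ← mul_assoc, mul_comm lam, mul_assoc, ← integral_const_mul lam]
    congr 2
    ext x
    rw [show (fun z => w z * ((w z)⁻¹ * φ z)) = φ from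
      funext fun z => mul_inv_cancel_left₀ (hw z).ne' _]
    have := (hw x).ne'
    field_simp
  · rw [hρ]
    have : ∀ x, (w x)⁻¹ * (c⁻¹ * w x) = c⁻¹ := fun x => by
      have := (hw x).ne'
      field_simp
    simp only [this]
    simp [hcpos.ne']

/-- Existence gives the `Classical.epsilon` choice its properties. The later estimates hold for any
such triple, so they do not depend on uniqueness. -/
theorem isRPF_rpf {f : (ℕ → M) → ℝ} (hf : IsLip f) :
    IsRPF ν f (mainEigenvalue ν f) (mainEigenfunction ν f) (rpf ν f).2.2 := by
  obtain ⟨lam, w, ρ, h⟩ := exists_isRPF (ν := ν) hd hf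
  exact Classical.epsilon_spec
    (p := fun t : ℝ × ((ℕ → M) → ℝ) × Measure (ℕ → M) => IsRPF ν f t.1 t.2.1 t.2.2)
    ⟨(lam, w, ρ), h⟩

theorem isNormalized_normalization {f : (ℕ → M) → ℝ} (hf : IsLip f) :
    IsNormalized ν (normalization ν f) :=
  have h := isRPF_rpf (ν := ν) hd hf
  isNormalized_normalize hd hf h.lam_pos h.pos h.lip h.eigenfunction

theorem gibbs_spec {f : (ℕ → M) → ℝ} (hf : IsLip f) :
    IsProbabilityMeasure (gibbs ν f) ∧ IsDualEigen ν (normalization ν f) 1 (gibbs ν f) :=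
  Classical.epsilon_spec
    (p := fun μ => IsProbabilityMeasure μ ∧ IsDualEigen ν (normalization ν f) 1 μ)
    ((isNormalized_normalization hd hf).exists_invariant hd)

end Spec

/-! ### Taylor estimates for $e^{ty}$ with $|t|\le1$ and bounded $y$. -/

theorem abs_exp_mul_sub_one_le {t y P : ℝ} (ht : |t| ≤ 1) (hy : |y| ≤ P) :
    |Real.exp (t * y) - 1| ≤ |t| * (Real.exp P * P) := by
  have h1 : |t * y| ≤ P := by
    rw [abs_mul]
    nlinarith [abs_nonneg t, abs_nonneg y]
  have h2 := abs_exp_sub_exp_le h1 (b := 0) (by simpa using (abs_nonneg y).trans hy)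
  rw [Real.exp_zero, sub_zero, abs_mul] at h2
  refine h2.trans ?_
  rw [mul_left_comm]
  gcongr

theorem abs_exp_mul_sub_le {t y z P : ℝ} (ht : |t| ≤ 1) (hy : |y| ≤ P) (hz : |z| ≤ P) :
    |Real.exp (t * y) - Real.exp (t * z)| ≤ |t| * Real.exp P * |y - z| := by
  have h : ∀ {y}, |y| ≤ P → |t * y| ≤ P := fun {y} hy => by
    rw [abs_mul]
    nlinarith [abs_nonneg t, abs_nonneg y]
  refine (abs_exp_sub_exp_le (h hy) (h hz)).trans (le_of_eq ?_)
  rw [← mul_sub, abs_mul]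
  ring

/-- The $y$-derivative $t(e^{ty}-1)$ is $O(t^2)$. Hence $e^{t\psi}-1-t\psi$ has Lipschitz constant
$O(t^2)$, not merely sup norm. -/
theorem abs_exp_rem_sub_le {t y z P : ℝ} (ht : |t| ≤ 1) (hy : |y| ≤ P) (hz : |z| ≤ P) :
    |(Real.exp (t * y) - 1 - t * y) - (Real.exp (t * z) - 1 - t * z)| ≤
      t ^ 2 * (Real.exp P * P) * |y - z| := by
  have hd : ∀ x : ℝ, HasDerivAt (fun y => Real.exp (t * y) - 1 - t * y)
      (t * (Real.exp (t * x) - 1)) x := by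
    intro x
    have h1 : HasDerivAt (fun y : ℝ => t * y) t x := by
      simpa using (hasDerivAt_id x).const_mul t
    have := (h1.exp.sub_const 1).sub h1
    exact this.congr_deriv (by ring)
  have := (convex_Icc (-P) P).norm_image_sub_le_of_norm_hasDerivWithin_le
    (f := fun y => Real.exp (t * y) - 1 - t * y) (C := t ^ 2 * (Real.exp P * P))
    (fun x _ => (hd x).hasDerivWithinAt) (fun x hx => by
      rw [norm_mul, Real.norm_eq_abs, Real.norm_eq_abs, ← sq_abs, sq, mul_assoc]
      exact mul_le_mul_of_nonneg_left (abs_exp_mul_sub_one_le ht (abs_le.2 hx)) (abs_nonneg t))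
    (abs_le.1 hz) (abs_le.1 hy)
  simpa only [Real.norm_eq_abs] using this

theorem abs_exp_rem_le {t y P : ℝ} (ht : |t| ≤ 1) (hy : |y| ≤ P) :
    |Real.exp (t * y) - 1 - t * y| ≤ t ^ 2 * (Real.exp P * P * P) := by
  have hP : 0 ≤ P := (abs_nonneg y).trans hy
  have := abs_exp_rem_sub_le ht hy (z := 0) (by simpa using hP)
  simp only [mul_zero, Real.exp_zero, sub_self, sub_zero] at this
  refine this.trans ?_
  rw [mul_assoc]
  gcongr

theorem exp_mul_le {t y P : ℝ} (ht : |t| ≤ 1) (hy : |y| ≤ P) : Real.exp (t * y) ≤ Real.exp P := by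
  refine Real.exp_le_exp.2 ((le_abs_self _).trans ?_)
  rw [abs_mul]
  nlinarith [abs_nonneg t, abs_nonneg y]

/-! ### Perturbation of the eigendata, and linear response. -/

section Perturbation

variable {M : Type*} [MetricSpace M] [CompactSpace M] [MeasurableSpace M] [BorelSpace M]
  (hd : ∀ a b : M, dist a b ≤ 1) {ν : Measure M} [IsProbabilityMeasure ν] [Nonempty M]

/-- An absorption argument: some finite constant exists a priori, and iterating
$\rho\mapsto\alpha+\rho/2$ drives it to the fixed point $2\alpha$. -/
theorem LipBound.of_halving {r : (ℕ → M) → ℝ} (hr : IsLip r) {α : ℝ} (hα : 0 ≤ α)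
    (h : ∀ ρ, 0 ≤ ρ → LipBound ρ r → LipBound (α + ρ / 2) r) : LipBound (2 * α) r := by
  obtain ⟨ρ, hρ, hr⟩ := hr.exists_nonneg
  have hn : ∀ n : ℕ, LipBound (2 * α + ρ * (1 / 2) ^ n) r := by
    intro n
    induction n with
    | zero => exact hr.mono (by simp [hα])
    | succ n ih =>
      refine (h _ (by positivity) ih).mono (le_of_eq ?_)
      rw [pow_succ]
      ring
  intro x y
  have ht : Tendsto (fun n : ℕ => (2 * α + ρ * (1 / 2) ^ n) * seqDist x y) atTop
      (𝓝 (2 * α * seqDist x y)) := by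
    have := ((tendsto_pow_atTop_nhds_zero_of_lt_one (r := (1 / 2 : ℝ)) (by norm_num)
      (by norm_num)).const_mul ρ).const_add (2 * α)
    simpa using this.mul_const (seqDist x y)
  exact ge_of_tendsto' ht fun n => hn n x y

theorem abs_integral_sub_le {m : Measure (ℕ → M)} [IsProbabilityMeasure m]
    {φ χ : (ℕ → M) → ℝ} (hφ : Continuous φ) (hχ : Continuous χ) {B : ℝ}
    (h : ∀ x, |φ x - χ x| ≤ B) : |∫ x, φ x ∂m - ∫ x, χ x ∂m| ≤ B := by
  rw [← integral_sub (integrable_seq hφ) (integrable_seq hχ)]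
  have := norm_integral_le_of_norm_le_const (μ := m) (f := fun y => φ y - χ y) (ae_of_all _ h)
  simpa using this

namespace IsNormalized

variable {A : (ℕ → M) → ℝ} (hA : IsNormalized ν A) {m : Measure (ℕ → M)}
  [IsProbabilityMeasure m] (hm : IsDualEigen ν A 1 m)

include hA hm hd

/-- If `L_A ψ = 0`, the eigenvalue and the normalized eigenfunction of `L_{A + tψ}` are
`1 + O(t²)`. -/
theorem exists_eigen_perturbation {ψ : (ℕ → M) → ℝ} (hψ : IsLip ψ)
    (hψ0 : ∀ x, ruelle ν A ψ x = 0) : ∃ C t₀, 0 ≤ C ∧ 0 < t₀ ∧ t₀ ≤ 1 ∧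
      ∀ t Λ v, |t| ≤ t₀ → IsLip v → (∀ x, 0 < v x) → ∫ x, v x ∂m = 1 →
        (∀ x, ruelle ν A (fun z => Real.exp (t * ψ z) * v z) x = Λ * v x) →
        |Λ - 1| ≤ C * t ^ 2 ∧ ∀ x, |v x - 1| ≤ C * t ^ 2 := by
  have hc := hA.lip.continuous hd
  have hψc := hψ.continuous hd
  obtain ⟨P, hP0, hP⟩ := exists_abs_le hψc
  obtain ⟨Q, hQ0, hQ⟩ := hψ.exists_nonneg
  obtain ⟨CA, hCA0, hCA⟩ := (hA.lip.exp hd).exists_nonneg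
  obtain ⟨D, hD0, hD⟩ := hA.exists_lipBound_of_sub hd hm
  have hψm : ∫ x, ψ x ∂m = 0 := by
    have := hm ψ hψc
    simp only [hψ0, integral_zero, one_mul] at this
    exact this.symm
  set E := Real.exp P with hE
  have hE0 : 0 < E := Real.exp_pos P
  set c₁ := (1 + CA) / 2 with hc₁
  have hc₁0 : 0 ≤ c₁ := by positivity
  have hLip : ∀ {l h}, 0 ≤ l → LipBound l h → LipBound (c₁ * l) (ruelle ν A h) := by
    intro l h hl hh
    refine (hA.lipBound_ruelle hd hCA (hh.abs_sub_le hd hl) hh).mono (le_of_eq ?_)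
    rw [hc₁]
    ring
  set a := c₁ * (E * P * Q) with ha
  set b := c₁ * (E * P + E * Q) + E * P with hb
  have ha0 : 0 ≤ a := by positivity
  have hb0 : 0 ≤ b := by positivity
  refine ⟨2 * (D * a) + (E * P * P + E * (2 * (D * a))), min 1 (1 / (2 * (D * b + 1))),
    by positivity, by positivity, min_le_left _ _, fun t Λ v ht hv hvpos hv1 heig => ?_⟩
  have ht1 : |t| ≤ 1 := ht.trans (min_le_left _ _)
  have ht2 : D * b * |t| ≤ 1 / 2 := by
    have h1 := ht.trans (min_le_right _ _)
    rw [le_div_iff₀ (by positivity)] at h1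
    nlinarith [abs_nonneg t, mul_nonneg hD0 hb0]
  have hvc := hv.continuous hd
  have hec : Continuous fun z => Real.exp (t * ψ z) := (continuous_const.fun_mul hψc).rexp
  have hΛ : Λ = ∫ x, Real.exp (t * ψ x) * v x ∂m := by
    have := hm _ (hec.fun_mul hvc)
    simp only [heig] at this
    rwa [integral_const_mul, hv1, mul_one, one_mul] at this
  -- A first-order bound needing no prior control of $v$: positivity and $\int v\,dm=1$ suffice.
  have hΛ1 : |Λ - 1| ≤ |t| * (E * P) := by
    rw [hΛ, ← hv1, ← integral_sub (integrable_seq (hec.fun_mul hvc)) (integrable_seq hvc)]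
    have := norm_integral_le_of_norm_le (μ := m) (f := fun x => Real.exp (t * ψ x) * v x - v x)
      (g := fun x => |t| * (E * P) * v x) (integrable_seq (continuous_const.fun_mul hvc))
      (ae_of_all _ fun x => by
        rw [show Real.exp (t * ψ x) * v x - v x = (Real.exp (t * ψ x) - 1) * v x by ring, norm_mul,
          Real.norm_of_nonneg (hvpos x).le]
        exact mul_le_mul_of_nonneg_right (abs_exp_mul_sub_one_le ht1 (hP x)) (hvpos x).le)
    rwa [integral_const_mul, hv1, mul_one, Real.norm_eq_abs] at this
  set r : (ℕ → M) → ℝ := fun x => v x - 1 with hr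
  have hrl : IsLip r := hv.sub (isLip_const 1)
  have hrc := hrl.continuous hd
  have hr0 : ∫ x, r x ∂m = 0 := by
    rw [hr, integral_sub (integrable_seq hvc) (integrable_const 1), hv1]
    simp
  have hrb : ∀ {ρ}, 0 ≤ ρ → LipBound ρ r → ∀ x, |r x| ≤ ρ := fun {ρ} hρ h x =>
    abs_le_of_integral_eq_zero hrc (h.abs_sub_le hd hρ) hr0 x
  have hRc : Continuous fun z => Real.exp (t * ψ z) - 1 - t * ψ z :=
    (hec.fun_sub continuous_const).sub (continuous_const.fun_mul hψc)
  -- The term $tL_A\psi$ has dropped out. The remaining free constant $1-\Lambda$ has Lipschitz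
  -- constant $0$, so the first-order bound on $\Lambda$ is enough here.
  have hF : ∀ x, r x - ruelle ν A r x =
      (ruelle ν A (fun z => Real.exp (t * ψ z) - 1 - t * ψ z) x +
        ruelle ν A (fun z => (Real.exp (t * ψ z) - 1) * r z) x) +
      ((1 - Λ) * r x + (1 - Λ)) := by
    intro x
    have h1 := heig x
    have e : (fun z => Real.exp (t * ψ z) * v z) = fun z =>
        (((Real.exp (t * ψ z) - 1 - t * ψ z) + (Real.exp (t * ψ z) - 1) * r z) + r z) +
          (t * ψ z + 1) := by
      ext z
      simp only [hr]
      ring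
    have hc2 := (hec.fun_sub (continuous_const (y := (1 : ℝ)))).fun_mul hrc
    rw [e, ruelle_add hc ((hRc.fun_add hc2).fun_add hrc)
      ((continuous_const.fun_mul hψc).fun_add continuous_const), ruelle_add hc (hRc.fun_add hc2) hrc,
      ruelle_add hc hRc hc2, ruelle_add hc (continuous_const.fun_mul hψc) continuous_const,
      ruelle_const_mul, hψ0, hA.ruelle_const] at h1
    simp only [hr] at h1 ⊢
    linarith
  -- The Lipschitz constant of $r-L_Ar$ is at most $at^2+b|t|\rho$. The choice of $t_0$ gives
  -- $Db|t|\le1/2$, so the feedback term is absorbed.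
  have hhalf : LipBound (2 * (D * (a * t ^ 2))) r := by
    refine LipBound.of_halving hrl (by positivity) fun ρ hρ hrρ => ?_
    have l1 : LipBound (t ^ 2 * (E * P) * Q) fun z => Real.exp (t * ψ z) - 1 - t * ψ z :=
      LipBound.comp (s := {y | |y| ≤ P}) hQ hP (by positivity)
        fun y hy z hz => abs_exp_rem_sub_le ht1 hy hz
    have l2 : LipBound (|t| * E * Q) fun z => Real.exp (t * ψ z) - 1 :=
      LipBound.comp (s := {y | |y| ≤ P}) (F := fun y => Real.exp (t * y) - 1) hQ hP (by positivity)
        fun y hy z hz => by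
          rw [sub_sub_sub_cancel_right]
          exact abs_exp_mul_sub_le ht1 hy hz
    have l3 := l2.mul hrρ (fun z => abs_exp_mul_sub_one_le ht1 (hP z)) (hrb hρ hrρ) (by positivity)
    have l4 := ((hLip (by positivity) l1).add (hLip (by positivity) l3)).add
      ((hrρ.const_mul (1 - Λ)).add (LipBound.const (1 - Λ)))
    have l5 : LipBound (a * t ^ 2 + b * |t| * ρ) fun x => r x - ruelle ν A r x := by
      rw [funext hF]
      refine l4.mono ?_
      have h6 : |1 - Λ| * ρ ≤ |t| * (E * P) * ρ := by
        rw [abs_sub_comm]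
        gcongr
      rw [ha, hb]
      linarith
    refine (hD _ r (by positivity) hrl l5).mono ?_
    nlinarith
  have hr2 : ∀ x, |r x| ≤ 2 * (D * a) * t ^ 2 := fun x =>
    (hrb (by positivity) hhalf x).trans (le_of_eq (by ring))
  refine ⟨?_, fun x => (hr2 x).trans ?_⟩
  · have h1 : Λ - 1 = ∫ x, (Real.exp (t * ψ x) * v x) ∂m - ∫ x, (1 + t * ψ x) ∂m := by
      rw [integral_add (integrable_const 1) (integrable_seq (continuous_const.fun_mul hψc)),
        integral_const_mul, hψm, ← hΛ]
      simp
    rw [h1]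
    refine (abs_integral_sub_le (hec.fun_mul hvc)
      (continuous_const.fun_add (continuous_const.fun_mul hψc))
      (B := (E * P * P + E * (2 * (D * a))) * t ^ 2) fun x => ?_).trans ?_
    · have e : Real.exp (t * ψ x) * v x - (1 + t * ψ x) =
          (Real.exp (t * ψ x) - 1 - t * ψ x) + Real.exp (t * ψ x) * r x := by
        simp only [hr]
        ring
      rw [e]
      refine (abs_add_le _ _).trans ?_
      have h2 := abs_exp_rem_le ht1 (hP x)
      have h3 : |Real.exp (t * ψ x) * r x| ≤ E * (2 * (D * a) * t ^ 2) := by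
        rw [abs_mul, abs_of_pos (Real.exp_pos _)]
        exact mul_le_mul (exp_mul_le ht1 (hP x)) (hr2 x) (abs_nonneg _) hE0.le
      linarith
    · have : 0 ≤ 2 * (D * a) * t ^ 2 := by positivity
      linarith
  · have : 0 ≤ (E * P * P + E * (2 * (D * a))) * t ^ 2 := by positivity
    linarith

/-- Linear response for `ψ` with `L_A ψ = 0`: the invariant probability `m'` of the normalization
of `A + tψ` gives `ψ` the mean `t ∫ ψ² dm + O(t²)`. -/
theorem exists_linear_response {ψ : (ℕ → M) → ℝ} (hψ : IsLip ψ)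
    (hψ0 : ∀ x, ruelle ν A ψ x = 0) {C₁ : ℝ} (hC₁ : 0 ≤ C₁) : ∃ C, 0 ≤ C ∧
      ∀ t Λ v (m' : Measure (ℕ → M)), |t| ≤ 1 → 8 * (C₁ * t ^ 2) ≤ 1 → Continuous v →
        |Λ - 1| ≤ C₁ * t ^ 2 → (∀ x, |v x - 1| ≤ C₁ * t ^ 2) → IsProbabilityMeasure m' →
        (∀ φ, Continuous φ → ∫ x, φ x ∂m' =
          ∫ x, ruelle ν A (fun z => Real.exp (t * ψ z) * v z * φ z) x / (Λ * v x) ∂m') →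
        |∫ x, ψ x ∂m' - t * ∫ x, ψ x ^ 2 ∂m| ≤ C * t ^ 2 := by
  have hc := hA.lip.continuous hd
  have hψc := hψ.continuous hd
  obtain ⟨P, hP0, hP⟩ := exists_abs_le hψc
  obtain ⟨D, hD0, hD⟩ := hA.exists_poisson hd hm
  have hψ2 : IsLip fun x => ψ x ^ 2 := by
    simp only [sq]
    exact hψ.mul hd hψ
  have hψ2c := hψ2.continuous hd
  set κ := ∫ x, ψ x ^ 2 ∂m with hκ
  have hhl := (hA.isLip_ruelle hd hψ2).sub (isLip_const κ)
  obtain ⟨l, hl0, hl⟩ := hhl.exists_nonneg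
  -- This $H$ turns $\int L_A(\psi^2)\,dm'-\kappa$ into $\int(H-L_AH)\,dm'$. That is $O(t)$ by
  -- invariance of $m'$, so no prior continuity of $t\mapsto m'$ is required.
  obtain ⟨H, hH, hHe⟩ := hD l _ hl0 hl (by
    rw [integral_sub (integrable_seq (continuous_ruelle hc hψ2c)) (integrable_const κ), hm _ hψ2c]
    simp [hκ])
  have hHc := hH.continuous hd
  obtain ⟨B, hB0, hB⟩ := exists_abs_le hHc
  set E := Real.exp P with hE
  have hE0 : 0 < E := Real.exp_pos P
  set C₃ := E * P * P + E * C₁ with hC₃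
  have hC₃0 : 0 ≤ C₃ := by positivity
  refine ⟨6 * C₁ * (P * P + C₃ * P) + C₃ * P + (6 * C₁ * (B + (P + C₃) * B) + (P + C₃) * B),
    by positivity, fun t Λ v m' ht hsmall hvc hΛ hv hm' hint => ?_⟩
  have hτ0 : 0 ≤ C₁ * t ^ 2 := by positivity
  have ht2 : t ^ 2 ≤ |t| := by
    rw [← sq_abs]
    nlinarith [abs_nonneg t]
  have ht2' : t ^ 2 = |t| * |t| := by rw [← sq_abs, sq]
  have hden : ∀ x, |Λ * v x - 1| ≤ 3 * (C₁ * t ^ 2) := by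
    intro x
    have h1 := abs_le.1 (hv x)
    have h2 := abs_le.1 hΛ
    rw [abs_le]
    constructor <;> nlinarith
  have hden2 : ∀ x, 1 / 2 ≤ Λ * v x := fun x => by linarith [(abs_le.1 (hden x)).1]
  have hq : ∀ x, |(Λ * v x)⁻¹ - 1| ≤ 6 * (C₁ * t ^ 2) := by
    intro x
    have hpos : 0 < Λ * v x := by linarith [hden2 x]
    have e : (Λ * v x)⁻¹ - 1 = -((Λ * v x - 1) * (Λ * v x)⁻¹) := by
      rw [sub_mul, mul_inv_cancel₀ hpos.ne']
      ring
    have h2 : (Λ * v x)⁻¹ ≤ 2 := by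
      rw [inv_le_comm₀ hpos two_pos]
      linarith [hden2 x]
    rw [e, abs_neg, abs_mul, abs_of_pos (inv_pos.2 hpos)]
    calc |Λ * v x - 1| * (Λ * v x)⁻¹ ≤ 3 * (C₁ * t ^ 2) * 2 := by
          gcongr
          exact hden x
      _ = _ := by ring
  have hec : Continuous fun z => Real.exp (t * ψ z) := (continuous_const.fun_mul hψc).rexp
  set R : (ℕ → M) → ℝ := fun z => Real.exp (t * ψ z) * v z - 1 - t * ψ z with hR
  have hRc : Continuous R := ((hec.fun_mul hvc).fun_sub continuous_const).sub
    (continuous_const.fun_mul hψc)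
  have hRb : ∀ x, |R x| ≤ C₃ * t ^ 2 := by
    intro x
    have e : R x = (Real.exp (t * ψ x) - 1 - t * ψ x) + Real.exp (t * ψ x) * (v x - 1) := by
      rw [hR]
      ring
    rw [e]
    refine (abs_add_le _ _).trans ?_
    have h2 := abs_exp_rem_le ht (hP x)
    have h3 : |Real.exp (t * ψ x) * (v x - 1)| ≤ E * (C₁ * t ^ 2) := by
      rw [abs_mul, abs_of_pos (Real.exp_pos _)]
      exact mul_le_mul (exp_mul_le ht (hP x)) (hv x) (abs_nonneg _) hE0.le
    rw [hC₃]
    linarith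
  have hmulb : ∀ {φ : (ℕ → M) → ℝ} {χ : (ℕ → M) → ℝ} {b b' : ℝ}, (∀ x, |φ x| ≤ b) →
      (∀ x, |χ x| ≤ b') → ∀ x, |φ x * χ x| ≤ b * b' := fun h h' x => by
    rw [abs_mul]
    exact mul_le_mul (h x) (h' x) (abs_nonneg _) ((abs_nonneg _).trans (h x))
  -- Invariance of $m'$ tested on `φ`: if `G₀` approximates the operator before division by $\Lambda
  -- v$ up to `e`, the division costs only a further $O(t^2)$ factor.
  have hcore : ∀ {φ G₀ : (ℕ → M) → ℝ} {b e : ℝ}, Continuous φ → Continuous G₀ →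
      (∀ x, |ruelle ν A (fun z => Real.exp (t * ψ z) * v z * φ z) x - G₀ x| ≤ e) →
      (∀ x, |G₀ x| ≤ b) →
      |∫ x, φ x ∂m' - ∫ x, G₀ x ∂m'| ≤ 6 * (C₁ * t ^ 2) * (b + e) + e := by
    intro φ G₀ b e hφ hG₀ h1 h2
    have hLc : Continuous (ruelle ν A fun z => Real.exp (t * ψ z) * v z * φ z) :=
      continuous_ruelle hc ((hec.fun_mul hvc).fun_mul hφ)
    rw [hint φ hφ]
    have hdiv : Continuous fun x =>
        ruelle ν A (fun z => Real.exp (t * ψ z) * v z * φ z) x / (Λ * v x) :=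
      hLc.div (continuous_const.mul hvc) fun x => by
        have := hden2 x
        exact ne_of_gt (show 0 < Λ * v x by linarith)
    refine abs_integral_sub_le hdiv hG₀ fun x => ?_
    set G := ruelle ν A (fun z => Real.exp (t * ψ z) * v z * φ z) x
    have e1 : G / (Λ * v x) - G₀ x = ((Λ * v x)⁻¹ - 1) * G + (G - G₀ x) := by
      rw [div_eq_mul_inv]
      ring
    have h3 : |G| ≤ b + e := by
      have := abs_add_le (G₀ x) (G - G₀ x)
      rw [add_sub_cancel] at this
      linarith [h1 x, h2 x]
    rw [e1]
    refine (abs_add_le _ _).trans (add_le_add ?_ (h1 x))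
    rw [abs_mul]
    exact mul_le_mul (hq x) h3 (abs_nonneg _) (by positivity)
  have hψ2b : ∀ x, |ψ x ^ 2| ≤ P * P := fun x => by
    rw [sq]
    exact hmulb hP hP x
  -- Expanding $e^{t\psi}v\psi=\psi+t\psi^2+O(t^2)$ and using $L_A\psi=0$.
  have key1 : |∫ x, ψ x ∂m' - ∫ x, t * ruelle ν A (fun z => ψ z ^ 2) x ∂m'| ≤
      6 * (C₁ * t ^ 2) * (P * P + C₃ * t ^ 2 * P) + C₃ * t ^ 2 * P := by
    refine hcore hψc (continuous_const.mul (continuous_ruelle hc hψ2c)) (fun x => ?_) fun x => ?_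
    · have e1 : (fun z => Real.exp (t * ψ z) * v z * ψ z) = fun z =>
          (ψ z + t * ψ z ^ 2) + R z * ψ z := by
        ext z
        simp only [hR]
        ring
      rw [e1, ruelle_add hc (hψc.fun_add (continuous_const.fun_mul hψ2c)) (hRc.fun_mul hψc),
        ruelle_add hc hψc (continuous_const.fun_mul hψ2c), ruelle_const_mul, hψ0, zero_add,
        add_sub_cancel_left]
      exact hA.abs_ruelle_le hd (hRc.fun_mul hψc) (hmulb hRb hP) x
    · rw [abs_mul, ← one_mul (P * P)]
      exact mul_le_mul ht (hA.abs_ruelle_le hd hψ2c hψ2b x) (abs_nonneg _) zero_le_one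
  have key2 : |∫ x, H x ∂m' - ∫ x, ruelle ν A H x ∂m'| ≤
      6 * (C₁ * t ^ 2) * (B + |t| * (P + C₃) * B) + |t| * (P + C₃) * B := by
    refine hcore hHc (continuous_ruelle hc hHc) (fun x => ?_) fun x => hA.abs_ruelle_le hd hHc hB x
    have hTc : Continuous fun z => (t * ψ z + R z) * H z :=
      ((continuous_const.fun_mul hψc).fun_add hRc).fun_mul hHc
    have e1 : (fun z => Real.exp (t * ψ z) * v z * H z) = fun z => H z + (t * ψ z + R z) * H z := by
      ext z
      simp only [hR]
      ring
    rw [e1, ruelle_add hc hHc hTc, add_sub_cancel_left]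
    refine hA.abs_ruelle_le hd hTc (hmulb (fun z => ?_) hB) x
    refine (abs_add_le _ _).trans ?_
    rw [abs_mul, mul_add]
    refine add_le_add (mul_le_mul_of_nonneg_left (hP z) (abs_nonneg t)) ((hRb z).trans ?_)
    rw [mul_comm]
    exact mul_le_mul_of_nonneg_right ht2 hC₃0
  rw [integral_const_mul] at key1
  have e2 : ∫ x, ruelle ν A (fun z => ψ z ^ 2) x ∂m' - κ =
      ∫ x, H x ∂m' - ∫ x, ruelle ν A H x ∂m' := by
    rw [← integral_sub (integrable_seq hHc) (integrable_seq (continuous_ruelle hc hHc))]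
    simp only [hHe]
    rw [integral_sub (integrable_seq (continuous_ruelle hc hψ2c)) (integrable_const κ)]
    simp
  rw [← e2] at key2
  set I := ∫ x, ruelle ν A (fun z => ψ z ^ 2) x ∂m'
  -- The $O(t)$ error of `key2` gains a factor $|t|$, so both errors are $O(t^2)$.
  have h3 : |∫ x, ψ x ∂m' - t * κ| ≤ |∫ x, ψ x ∂m' - t * I| + |t| * |I - κ| := by
    rw [← abs_mul, show ∫ x, ψ x ∂m' - t * κ = (∫ x, ψ x ∂m' - t * I) + t * (I - κ) by ring]
    exact abs_add_le _ _
  have ht21 : t ^ 2 ≤ 1 := ht2.trans ht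
  have h4 : 6 * (C₁ * t ^ 2) * (P * P + C₃ * t ^ 2 * P) ≤ 6 * (C₁ * t ^ 2) * (P * P + C₃ * P) := by
    gcongr
    exact mul_le_of_le_one_right hC₃0 ht21
  have h5 : |t| * (6 * (C₁ * t ^ 2) * (B + |t| * (P + C₃) * B)) ≤
      1 * (6 * (C₁ * t ^ 2) * (B + 1 * (P + C₃) * B)) := by
    gcongr
  have h6 := mul_le_mul_of_nonneg_left key2 (abs_nonneg t)
  have h7 : |t| * (|t| * (P + C₃) * B) = t ^ 2 * ((P + C₃) * B) := by rw [ht2']; ring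
  rw [mul_add, h7] at h6
  linarith

end IsNormalized

end Perturbation

/-! ### The asymptotic variance and the expansion of the pressure. -/

section Variance

variable {M : Type*} [MetricSpace M] [CompactSpace M] [MeasurableSpace M] [BorelSpace M]
  (hd : ∀ a b : M, dist a b ≤ 1) {ν : Measure M} [IsProbabilityMeasure ν] [Nonempty M]

theorem continuous_comp_iterate_shift {φ : (ℕ → M) → ℝ} (hφ : Continuous φ) (n : ℕ) :
    Continuous fun x => φ (shift^[n] x) :=
  hφ.comp (continuous_shift.iterate n)

namespace IsNormalized

variable {A : (ℕ → M) → ℝ} (hA : IsNormalized ν A) {m : Measure (ℕ → M)}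
  [IsProbabilityMeasure m] (hm : IsDualEigen ν A 1 m)

include hA hm

theorem integral_comp_shift {φ : (ℕ → M) → ℝ} (hφ : Continuous φ) :
    ∫ x, φ (shift x) ∂m = ∫ x, φ x ∂m := by
  have := hm _ (hφ.comp continuous_shift)
  rw [one_mul] at this
  rw [← Function.comp_def φ shift, ← this]
  exact integral_congr_ae (ae_of_all _ fun x => hA.ruelle_comp_shift φ x)

/-- Birkhoff sums of `ψ` with `L_A ψ = 0` have orthogonal increments. -/
theorem integral_sum_sq {ψ : (ℕ → M) → ℝ} (hψ : Continuous ψ)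
    (hψ0 : ∀ x, ruelle ν A ψ x = 0) (n : ℕ) :
    ∫ x, (∑ j ∈ Finset.range n, ψ (shift^[j] x)) ^ 2 ∂m = n * ∫ x, ψ x ^ 2 ∂m := by
  induction n with
  | zero => simp
  | succ n ih =>
    set S : (ℕ → M) → ℝ := fun x => ∑ j ∈ Finset.range n, ψ (shift^[j] x) with hS
    have hSc : Continuous S :=
      continuous_finsetSum _ fun j _ => continuous_comp_iterate_shift hψ j
    have hSs : Continuous fun x => S (shift x) := hSc.comp continuous_shift
    have e : ∀ x, (∑ j ∈ Finset.range (n + 1), ψ (shift^[j] x)) ^ 2 =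
        (ψ x ^ 2 + 2 * (ψ x * S (shift x))) + S (shift x) ^ 2 := by
      intro x
      rw [Finset.sum_range_succ']
      simp only [Function.iterate_succ_apply, Function.iterate_zero, id, hS]
      ring
    -- $L_A(\psi\cdot S\circ\sigma)=S\,L_A\psi=0$, and $m$ is invariant.
    have hcross : ∫ x, ψ x * S (shift x) ∂m = 0 := by
      have := hm (fun x => ψ x * S (shift x)) (hψ.fun_mul hSs)
      rw [one_mul] at this
      rw [← this]
      simp [ruelle_mul_comp_shift, hψ0]
    simp only [e]
    rw [integral_add (integrable_seq ((hψ.fun_pow 2).fun_add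
        (continuous_const.fun_mul (hψ.fun_mul hSs)))) (integrable_seq (hSs.fun_pow 2)),
      integral_add (integrable_seq (hψ.fun_pow 2))
        (integrable_seq (continuous_const.fun_mul (hψ.fun_mul hSs))),
      integral_const_mul, hcross,
      hA.integral_comp_shift hm (φ := fun x => S x ^ 2) (hSc.fun_pow 2), ih]
    push_cast
    ring

/-- The asymptotic variance of a function cohomologous to `ψ` with `L_A ψ = 0` is `∫ ψ² dm`. -/
theorem tendsto_variance {ψ u h : (ℕ → M) → ℝ} (hψ : Continuous ψ) (hu : Continuous u)
    (hψ0 : ∀ x, ruelle ν A ψ x = 0) (hh : ∀ x, h x = ψ x - u x + u (shift x)) :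
    Tendsto (fun n : ℕ => (1 / (n : ℝ)) *
      ∫ x, (∑ j ∈ Finset.range n, h (shift^[j] x)) ^ 2 ∂m) atTop (𝓝 (∫ x, ψ x ^ 2 ∂m)) := by
  obtain ⟨B, hB0, hB⟩ := exists_abs_le hu
  set κ := ∫ x, ψ x ^ 2 ∂m with hκ
  have hκ0 : 0 ≤ κ := integral_nonneg fun x => sq_nonneg _
  have hsum : ∀ (n : ℕ) x, ∑ j ∈ Finset.range n, h (shift^[j] x) =
      ∑ j ∈ Finset.range n, ψ (shift^[j] x) + (u (shift^[n] x) - u x) := by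
    intro n x
    have := Finset.sum_range_sub (fun j => u (shift^[j] x)) n
    rw [Function.iterate_zero, id] at this
    rw [← this, ← Finset.sum_add_distrib]
    refine Finset.sum_congr rfl fun j _ => ?_
    rw [hh, Function.iterate_succ_apply']
    ring
  have hbound : ∀ n : ℕ, 0 < n →
      |(1 / (n : ℝ)) * ∫ x, (∑ j ∈ Finset.range n, h (shift^[j] x)) ^ 2 ∂m - κ| ≤
        (√n)⁻¹ * (κ + 4 * B ^ 2 + 4 * B ^ 2) := by
    intro n hn
    have hn0 : (0 : ℝ) < n := Nat.cast_pos.2 hn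
    have hn1 : (1 : ℝ) ≤ n := Nat.one_le_cast.2 hn
    set q := √(n : ℝ) with hq
    have hq0 : 0 < q := Real.sqrt_pos.2 hn0
    have hqn : q * q = n := Real.mul_self_sqrt hn0.le
    have hq1 : 1 ≤ q := Real.one_le_sqrt.2 hn1
    set S : (ℕ → M) → ℝ := fun x => ∑ j ∈ Finset.range n, ψ (shift^[j] x) with hS
    have hSc : Continuous S :=
      continuous_finsetSum _ fun j _ => continuous_comp_iterate_shift hψ j
    have hec : Continuous fun x => u (shift^[n] x) - u x :=
      (continuous_comp_iterate_shift hu n).fun_sub hu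
    have hS2 : ∫ x, S x ^ 2 ∂m = n * κ := hA.integral_sum_sq hm hψ hψ0 n
    have hpt : ∀ x, ‖(S x + (u (shift^[n] x) - u x)) ^ 2 - S x ^ 2‖ ≤
        q⁻¹ * S x ^ 2 + (q * (4 * B ^ 2) + 4 * B ^ 2) := by
      intro x
      set e := u (shift^[n] x) - u x
      have he : |e| ≤ 2 * B := (abs_sub _ _).trans (by linarith [hB (shift^[n] x), hB x])
      have he2 : e ^ 2 ≤ 4 * B ^ 2 := by
        rw [← sq_abs]
        nlinarith [abs_nonneg e]
      have e1 : (S x + e) ^ 2 - S x ^ 2 = 2 * (S x * e) + e ^ 2 := by ring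
      -- Young's inequality with weight $\sqrt n$: since $\int S^2\,dm=n\kappa$ and `e` is bounded,
      -- both terms are $O(\sqrt n)$ after integration.
      have e2 : 2 * |S x * e| ≤ q⁻¹ * S x ^ 2 + q * e ^ 2 := by
        have h1 : 0 ≤ q⁻¹ * (|S x| - q * |e|) ^ 2 := by positivity
        have h2 : q⁻¹ * (|S x| - q * |e|) ^ 2 =
            q⁻¹ * |S x| ^ 2 - 2 * (|S x| * |e|) + q * |e| ^ 2 := by
          field_simp
          ring
        rw [h2, sq_abs, sq_abs] at h1
        rw [abs_mul]
        linarith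
      rw [e1]
      refine (norm_add_le _ _).trans ?_
      rw [Real.norm_eq_abs, Real.norm_eq_abs, abs_mul, abs_two, abs_of_nonneg (sq_nonneg e)]
      have := mul_le_mul_of_nonneg_left he2 hq0.le
      linarith
    have hT : |∫ x, (S x + (u (shift^[n] x) - u x)) ^ 2 ∂m - n * κ| ≤
        q⁻¹ * (n * κ) + (q * (4 * B ^ 2) + 4 * B ^ 2) := by
      rw [← hS2, ← integral_sub (integrable_seq ((hSc.fun_add hec).fun_pow 2))
        (integrable_seq (hSc.fun_pow 2))]
      have i1 : Integrable (fun x => q⁻¹ * S x ^ 2) m :=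
        integrable_seq (continuous_const.fun_mul (hSc.fun_pow 2))
      have := norm_integral_le_of_norm_le (i1.add (integrable_const
        (q * (4 * B ^ 2) + 4 * B ^ 2))) (ae_of_all _ hpt)
      rw [integral_add' i1 (integrable_const _), integral_const_mul] at this
      simpa using this
    simp only [hsum]
    have e3 : (1 / (n : ℝ)) * ∫ x, (S x + (u (shift^[n] x) - u x)) ^ 2 ∂m - κ =
        (1 / (n : ℝ)) * (∫ x, (S x + (u (shift^[n] x) - u x)) ^ 2 ∂m - n * κ) := by
      field_simp
    rw [e3, abs_mul, abs_of_pos (by positivity)]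
    refine (mul_le_mul_of_nonneg_left hT (by positivity)).trans ?_
    rw [← hqn]
    have e4 : 1 / (q * q) * (q⁻¹ * (q * q * κ) + (q * (4 * B ^ 2) + 4 * B ^ 2)) =
        q⁻¹ * (κ + 4 * B ^ 2 + q⁻¹ * (4 * B ^ 2)) := by
      field_simp
      ring
    rw [e4]
    refine mul_le_mul_of_nonneg_left (add_le_add_right ?_ _) (by positivity)
    exact mul_le_of_le_one_left (by positivity) (inv_le_one_of_one_le₀ hq1)
  rw [tendsto_iff_dist_tendsto_zero]
  have ht : Tendsto (fun n : ℕ => (√(n : ℝ))⁻¹ * (κ + 4 * B ^ 2 + 4 * B ^ 2)) atTop (𝓝 0) := by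
    have h1 : Tendsto (fun n : ℕ => √(n : ℝ)) atTop atTop :=
      Real.tendsto_sqrt_atTop.comp tendsto_natCast_atTop_atTop
    simpa using (tendsto_inv_atTop_zero.comp h1).mul_const (κ + 4 * B ^ 2 + 4 * B ^ 2)
  refine squeeze_zero' (Eventually.of_forall fun _ => dist_nonneg) ?_ ht
  filter_upwards [eventually_gt_atTop 0] with n hn
  exact hbound n hn

include hd

/-- Every Lipschitz function is, up to its mean and a coboundary, a function killed by `L_A`. -/
theorem exists_martingale_coboundary {g : (ℕ → M) → ℝ} (hg : IsLip g) :
    ∃ ψ u : (ℕ → M) → ℝ, IsLip ψ ∧ IsLip u ∧ (∀ x, ruelle ν A ψ x = 0) ∧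
      ∀ x, g x - ∫ y, g y ∂m = ψ x - u x + u (shift x) := by
  have hc := hA.lip.continuous hd
  obtain ⟨D, -, hD⟩ := hA.exists_poisson hd hm
  set c := ∫ y, g y ∂m with hcdef
  have hgl : IsLip fun x => g x - c := hg.sub (isLip_const c)
  have hgc := hgl.continuous hd
  obtain ⟨l, hl0, hl⟩ := (hA.isLip_ruelle hd hgl).exists_nonneg
  -- Solving $u-L_Au=L_A(g-c)$, instead of with right side $g-c$, is what makes
  -- $\psi=g-c+u-u\circ\sigma$ satisfy $L_A\psi=L_A(g-c)+L_Au-u=0$.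
  obtain ⟨u, hu, hue⟩ := hD l _ hl0 hl (by
    rw [hm _ hgc, integral_sub (integrable_seq (hg.continuous hd)) (integrable_const c)]
    simp [hcdef])
  have huc := hu.continuous hd
  refine ⟨fun x => (g x - c + u x) - u (shift x), u,
    (hgl.add hu.isLip).sub (hu.isLip.comp_shift hd), hu.isLip, fun x => ?_, fun x => by ring⟩
  have hus : Continuous fun x => u (shift x) := huc.comp continuous_shift
  rw [ruelle_sub hc (hgc.fun_add huc) hus, ruelle_add hc hgc huc,
    hA.ruelle_comp_shift, ← hue]
  ring

end IsNormalized

/-- The coboundary $u$ and both eigenfunctions are absorbed in $v=\alpha w'e^{-tu}/w$, and the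
constants in $\Lambda=\lambda'/(\lambda e^{tc})$. This identifies $L_{N(f+(s+t)g)}$ with the
normalization of $L_{A+t\psi}$. -/
theorem ruelle_normalization_perturb {f f' w w' ψ u v g A A' : (ℕ → M) → ℝ}
    {lam lam' c t α : ℝ} (hlam : 0 < lam) (hlam' : 0 < lam') (hα : 0 < α)
    (hw : ∀ x, 0 < w x) (hw' : ∀ x, 0 < w' x)
    (hA : A = fun x => f x + Real.log (w x) - Real.log (w (shift x)) - Real.log lam)
    (hA' : A' = fun x => f' x + Real.log (w' x) - Real.log (w' (shift x)) - Real.log lam')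
    (hf : ∀ x, f' x = f x + t * g x) (hg : ∀ x, g x - c = ψ x - u x + u (shift x))
    (hv : ∀ x, v x = α * (w' x * Real.exp (-(t * u x) - Real.log (w x))))
    (φ : (ℕ → M) → ℝ) (x : ℕ → M) :
    ruelle ν A (fun z => Real.exp (t * ψ z) * v z * φ z) x /
      (lam' / (lam * Real.exp (t * c)) * v x) = ruelle ν A' φ x := by
  rw [hA, hA']
  simp only [ruelle, exp_normalize hlam hw, exp_normalize hlam' hw']
  rw [div_eq_mul_inv, ← integral_mul_const]
  congr 1
  ext a
  have e1 : t * ψ (prepend a x) = t * g (prepend a x) + t * u (prepend a x) - t * c - t * u x := by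
    have := hg (prepend a x)
    rw [shift_prepend] at this
    linear_combination (-t) * this
  rw [hf, hv, hv, e1, Real.exp_add, Real.exp_sub, Real.exp_sub, Real.exp_sub, Real.exp_sub,
    Real.exp_add, Real.exp_log (hw _), Real.exp_log (hw _), Real.exp_neg, Real.exp_neg]
  have h1 := (hw x).ne'
  have h2 := (hw' x).ne'
  have h3 := (hw (prepend a x)).ne'
  field_simp

include hd in
/-- Second order expansion of the pressure along `f + tg`, and first order expansion of the mean
of `g` for the Gibbs probabilities, with the asymptotic variance as the coefficient. -/
theorem pressure_expansion {f g : (ℕ → M) → ℝ} (hf : IsLip f) (hg : IsLip g) (s : ℝ) :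
    ∃ κ C t₀ : ℝ, 0 < t₀ ∧
      (∀ t, |t| ≤ t₀ →
        |pressure ν (f + (s + t) • g) - pressure ν (f + s • g) -
            t * ∫ x, g x ∂(gibbs ν (f + s • g))| ≤ C * t ^ 2 ∧
        |∫ x, g x ∂(gibbs ν (f + (s + t) • g)) - ∫ x, g x ∂(gibbs ν (f + s • g)) - t * κ| ≤
          C * t ^ 2) ∧
      Tendsto (fun n : ℕ => (1 / (n : ℝ)) *
        ∫ x, (∑ j ∈ Finset.range n,
          (g (shift^[j] x) - ∫ y, g y ∂(gibbs ν (f + s • g)))) ^ 2 ∂(gibbs ν (f + s • g)))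
        atTop (𝓝 κ) := by
  have hfs : ∀ r : ℝ, IsLip (f + r • g) := fun r => hf.add (hg.const_mul r)
  have hrpf := fun r : ℝ => isRPF_rpf (ν := ν) hd (hfs r)
  have hA := fun r : ℝ => isNormalized_normalization (ν := ν) hd (hfs r)
  have hgc := hg.continuous hd
  obtain ⟨hprob, hm⟩ := gibbs_spec (ν := ν) hd (hfs s)
  set m := gibbs ν (f + s • g) with hmdef
  obtain ⟨ψ, u, hψ, hu, hψ0, hcob⟩ := (hA s).exists_martingale_coboundary hd hm hg
  set c := ∫ x, g x ∂m with hcdef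
  have huc := hu.continuous hd
  have hψc := hψ.continuous hd
  obtain ⟨C₁, t₁, hC₁, ht₁, ht₁', h₁⟩ := (hA s).exists_eigen_perturbation hd hm hψ hψ0
  obtain ⟨C₂, hC₂, h₂⟩ := (hA s).exists_linear_response hd hm hψ hψ0 hC₁
  refine ⟨∫ x, ψ x ^ 2 ∂m, 2 * C₁ + C₂, min t₁ (1 / (8 * (C₁ + 1))), by positivity,
    fun t ht => ?_, (hA s).tendsto_variance hm (h := fun x => g x - c) hψc huc hψ0 hcob⟩
  have htt₁ : |t| ≤ t₁ := ht.trans (min_le_left _ _)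
  have ht1 : |t| ≤ 1 := htt₁.trans ht₁'
  have hsmall : 8 * (C₁ * t ^ 2) ≤ 1 := by
    have h3 := ht.trans (min_le_right _ _)
    rw [le_div_iff₀ (by positivity)] at h3
    have h4 : t ^ 2 ≤ |t| := by
      rw [← sq_abs]
      nlinarith [abs_nonneg t]
    nlinarith [abs_nonneg t, mul_le_mul_of_nonneg_left h4 hC₁]
  obtain ⟨hprob', hm'⟩ := gibbs_spec (ν := ν) hd (hfs (s + t))
  set m' := gibbs ν (f + (s + t) • g) with hm'def
  set lam := mainEigenvalue ν (f + s • g) with hlam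
  set lam' := mainEigenvalue ν (f + (s + t) • g) with hlam'
  set w := mainEigenfunction ν (f + s • g) with hw
  set w' := mainEigenfunction ν (f + (s + t) • g) with hw'
  have hwpos : ∀ x, 0 < w x := (hrpf s).pos
  have hwpos' : ∀ x, 0 < w' x := (hrpf (s + t)).pos
  have hlampos : 0 < lam := (hrpf s).lam_pos
  have hlampos' : 0 < lam' := (hrpf (s + t)).lam_pos
  set v₀ : (ℕ → M) → ℝ := fun x => w' x * Real.exp (-(t * u x) - Real.log (w x)) with hv₀
  have hv₀l : IsLip v₀ := by
    refine (hrpf (s + t)).lip.mul hd (IsLip.exp hd (IsLip.sub ?_ ((hrpf s).lip.log hd hwpos)))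
    simpa only [neg_mul] using hu.const_mul (-t)
  have hv₀c := hv₀l.continuous hd
  have hv₀pos : ∀ x, 0 < v₀ x := fun x => mul_pos (hwpos' x) (Real.exp_pos _)
  obtain ⟨δ, hδ, hδv⟩ := exists_pos_le hv₀c hv₀pos
  have hI : 0 < ∫ x, v₀ x ∂m := by
    refine hδ.trans_le ?_
    simpa using integral_mono (integrable_const δ) (integrable_seq (m := m) hv₀c) hδv
  set α := (∫ x, v₀ x ∂m)⁻¹ with hα
  have hαpos : 0 < α := inv_pos.2 hI
  set v : (ℕ → M) → ℝ := fun x => α * v₀ x with hv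
  have hvl : IsLip v := hv₀l.const_mul α
  have hvpos : ∀ x, 0 < v x := fun x => mul_pos hαpos (hv₀pos x)
  have hv1 : ∫ x, v x ∂m = 1 := by
    rw [hv, integral_const_mul, hα, inv_mul_cancel₀ hI.ne']
  set Λ := lam' / (lam * Real.exp (t * c)) with hΛ
  have hΛpos : 0 < Λ := by positivity
  have hop : ∀ φ x, ruelle ν (normalization ν (f + s • g))
      (fun z => Real.exp (t * ψ z) * v z * φ z) x / (Λ * v x) =
        ruelle ν (normalization ν (f + (s + t) • g)) φ x :=
    ruelle_normalization_perturb (f := f + s • g) (f' := f + (s + t) • g) (g := g) hlampos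
      hlampos' hαpos hwpos hwpos' rfl rfl (fun x => by simp; ring) hcob (fun x => rfl)
  have heig : ∀ x, ruelle ν (normalization ν (f + s • g))
      (fun z => Real.exp (t * ψ z) * v z) x = Λ * v x := by
    intro x
    have h3 := hop (fun _ => 1) x
    simp only [mul_one] at h3
    rwa [(hA (s + t)).ruelle_const, div_eq_one_iff_eq (mul_pos hΛpos (hvpos x)).ne'] at h3
  obtain ⟨hΛ1, hv2⟩ := h₁ t Λ v htt₁ hvl hvpos hv1 heig
  have hresp := h₂ t Λ v m' ht1 hsmall (hvl.continuous hd) hΛ1 hv2 hprob' fun φ hφ => by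
    simp only [hop]
    rw [hm' φ hφ, one_mul]
  have ht2 : 0 ≤ t ^ 2 := sq_nonneg t
  constructor
  · have e : pressure ν (f + (s + t) • g) - pressure ν (f + s • g) - t * c =
        Real.log Λ - Real.log 1 := by
      rw [hΛ, Real.log_div hlampos'.ne' (by positivity), Real.log_mul hlampos.ne' (by positivity),
        Real.log_exp, Real.log_one, pressure, pressure]
      ring
    rw [e]
    -- On $[1/2,\infty)$ the logarithm is $2$-Lipschitz, which is the source of $2C_1$ in the final
    -- constant.
    have hhalf : 1 / 2 ≤ Λ := by linarith [(abs_le.1 hΛ1).1]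
    refine (abs_log_sub_log_le (by norm_num) hhalf (by norm_num)).trans ?_
    rw [one_div, inv_inv]
    nlinarith
  -- $m'$ is shift-invariant, so the coboundary has mean zero for it as well.
  · have e : ∫ x, ψ x ∂m' = ∫ x, g x ∂m' - c := by
      have h3 : ∀ x, ψ x = ((g x - c) + u x) - u (shift x) := fun x => by rw [hcob]; ring
      have hus : Continuous fun x => u (shift x) := huc.comp continuous_shift
      simp only [h3]
      rw [integral_sub (integrable_seq ((hgc.fun_sub continuous_const).fun_add huc))
        (integrable_seq hus), integral_add (integrable_seq (hgc.fun_sub continuous_const))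
        (integrable_seq huc), (hA (s + t)).integral_comp_shift hm' huc,
        integral_sub (integrable_seq hgc) (integrable_const c)]
      simp
    rw [e] at hresp
    nlinarith

end Variance

/-! ### From quadratic remainders to derivatives, and the theorem. -/

theorem hasDerivAt_of_abs_sub_le {F : ℝ → ℝ} {s F' C t₀ : ℝ} (ht₀ : 0 < t₀)
    (h : ∀ t, |t| ≤ t₀ → |F (s + t) - F s - t * F'| ≤ C * t ^ 2) : HasDerivAt F F' s := by
  rw [hasDerivAt_iff_isLittleO_nhds_zero]
  have h1 : (fun t => F (s + t) - F s - t • F') =O[𝓝 0] fun t : ℝ => t ^ 2 := by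
    refine Asymptotics.IsBigO.of_bound C ?_
    filter_upwards [Metric.closedBall_mem_nhds (0 : ℝ) ht₀] with t ht
    rw [Real.norm_eq_abs, Real.norm_of_nonneg (sq_nonneg t)]
    exact h t (by simpa using ht)
  refine h1.trans_isLittleO ?_
  simpa using Asymptotics.isLittleO_pow_pow (𝕜 := ℝ) one_lt_two

end XYModel

theorem lemma4p2 {M : Type*} [MetricSpace M] [CompactSpace M] [MeasurableSpace M] [BorelSpace M]
    (hM : Metric.diam (Set.univ : Set M) = 1)
    (ν : Measure M) [IsProbabilityMeasure ν] (hν : ν.support = Set.univ)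
    (f g : (ℕ → M) → ℝ) (hf : XYModel.IsLip f) (hg : XYModel.IsLip g)
    (hfg : ∫ x, g x ∂(XYModel.gibbs ν f) = 0)
    (p β : ℝ → ℝ) (hp : ∀ t, p t = XYModel.pressure ν (f + t • g))
    (hβ : ∀ t, β t = XYModel.pressure ν (f + t • g) - XYModel.pressure ν f) :
    Differentiable ℝ p ∧ Differentiable ℝ β ∧
    ∀ s : ℝ, ∃ v : ℝ, HasDerivAt (deriv p) v s ∧ HasDerivAt (deriv β) v s ∧
      Tendsto
        (fun n : ℕ => (1 / (n : ℝ)) *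
          ∫ x, (∑ j ∈ Finset.range n, (g (XYModel.shift^[j] x) - deriv β s)) ^ 2
            ∂(XYModel.gibbs ν (f + s • g)))
        atTop (𝓝 v) := by
  have hd := XYModel.dist_le_one hM
  have : Nonempty M := by
    by_contra h
    rw [not_nonempty_iff] at h
    simp [Set.univ_eq_empty_iff.2 h] at hM
  have hexp := XYModel.pressure_expansion (ν := ν) hd hf hg
  have hp' : ∀ s, HasDerivAt p (∫ x, g x ∂(XYModel.gibbs ν (f + s • g))) s := by
    intro s
    obtain ⟨κ, C, t₀, ht₀, h, -⟩ := hexp s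
    refine XYModel.hasDerivAt_of_abs_sub_le (C := C) ht₀ fun t ht => ?_
    rw [hp, hp]
    exact (h t ht).1
  have hβp : β = fun t => p t - XYModel.pressure ν f := funext fun t => by rw [hβ, hp]
  have hβ' : ∀ s, HasDerivAt β (∫ x, g x ∂(XYModel.gibbs ν (f + s • g))) s := fun s => by
    rw [hβp]
    exact (hp' s).sub_const _
  refine ⟨fun s => (hp' s).differentiableAt, fun s => (hβ' s).differentiableAt, fun s => ?_⟩
  -- Both derivatives are now the function $s\mapsto\int g\,d\mu_{f+sg}$, so the centring
  -- $\beta'(s)$ is the Gibbs mean and the linear response is the second derivative.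
  rw [deriv_eq hp', deriv_eq hβ']
  obtain ⟨κ, C, t₀, ht₀, h, hvar⟩ := hexp s
  have hmean : HasDerivAt (fun s => ∫ x, g x ∂(XYModel.gibbs ν (f + s • g))) κ s :=
    XYModel.hasDerivAt_of_abs_sub_le ht₀ fun t ht => (h t ht).2
  exact ⟨κ, hmean, hmean, hvar⟩
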